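/- Let $\mathscr{Y}$ be a measurable space with a $\sigma$-finite measure $dy$, let $\mathscr{U}$ be a finite set, let $p(\cdot\mid u)$, $u\in\mathscr{U}$, be probability densities on $\mathscr{Y}$, let $\mathbb{F}=\{f\in[0,1]^{\mathscr{U}}:\sum_u f(u)=1\}$, and put $m_f(y)=\sum_{u}p(y\mid u)f(u)$. Let $Y_1,Y_2,\dots$ be independent with common density $m$, which need not be of the form $m_f$. Let $K(m,m')=\int\log\{m(y)/m'(y)\}\,m(y)\,dy$ be the Kullback--Leibler divergence and assume that $K(m,m_f)<\infty$ for all $f\in\mathbb{F}$. Assume that the mixture is identifiable, i.e. $f\mapsto m_f$ is one-to-one on $\mathbb{F}$ (with densities regarded up to null sets), that $f^\star$ is the unique minimizer of $f\mapsto K(m,m_f)$ over $\mathbb{F}$, and that $f^\star$ lies in the (relative) interior of $\mathbb{F}$, i.e. $f^\star(u)>0$ for all $u$. (Continuity of $u\mapsto p(y\mid u)$ is automatic, since $\mathscr{U}$ is finite and so discrete.) Given $f_0\in\mathbb{F}$ with $f_0(u)>0$ for all $u$ and weights $w_1,w_2,\dots\in(0,1)$, the predictive recursion (PR) is $$f_i(u)=(1-w_i)f_{i-1}(u)+w_i\,\frac{p(Y_i\mid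 u)f_{i-1}(u)}{m_{f_{i-1}}(Y_i)},\qquad u\in\mathscr{U},\ i\ge 1.$$ (a) Suppose that $\sum_n w_n=\infty$, that $\sum_n w_n^{1+\varepsilon}<\infty$ for some $\varepsilon\in(0,1]$, and that $w_{n+1}^{-1}-w_n^{-1}\to0$. Then for every $\delta\in(0,(1-\varepsilon)/2]$, almost surely $\|f_n-f^\star\|=o(w_n^{\delta})$ as $n\to\infty$, where $\|\cdot\|$ is the Euclidean norm. (b) In particular, if $w_n=(n+1)^{-\gamma}$ with $\gamma\in(1/2,1)$, then for every $\beta<\gamma-1/2$, almost surely $\|f_n-f^\star\|=o(n^{-\beta})$. Since $\gamma$ can be taken arbitrarily close to $1$, every exponent $\beta<1/2$ can be reached, so the rate can be made arbitrarily close to $n^{-1/2}$. -/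

import Mathlib

open MeasureTheory ProbabilityTheory Filter Topology Asymptotics

namespace PredictiveRecursion

/-- `g` is a probability density with respect to the measure `lam`. -/
structure IsDensity {Y : Type*} [MeasurableSpace Y] (lam : Measure Y) (g : Y → ℝ) : Prop where
  measurable : Measurable g
  nonneg : ∀ y, 0 ≤ g y
  lintegral_eq_one : ∫⁻ y, ENNReal.ofReal (g y) ∂lam = 1

/-- The measure with density `g` with respect to `lam`. -/
noncomputable def law {Y : Type*} [MeasurableSpace Y] (lam : Measure Y) (g : Y → ℝ) : Measure Y :=
  lam.withDensity (fun y => ENNReal.ofReal (g y))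

/-- The Kullback-Leibler divergence `K(m, m') = ∫ log (m / m') m dlam` of the density `m'` from
the density `m`, with values in `[0, ∞]`. -/
noncomputable def KL {Y : Type*} [MeasurableSpace Y] (lam : Measure Y) (m m' : Y → ℝ) : ENNReal :=
  InformationTheory.klDiv (law lam m) (law lam m')

/-- The finite mixture `m_f(y) = ∑ u, p(y | u) f(u)`; here `p y u` is `p(y | u)`. -/
def mixture {Y U : Type*} [Fintype U] (p : Y → U → ℝ) (f : U → ℝ) (y : Y) : ℝ :=
  ∑ u, p y u * f u

/-- `f ↦ m_f` is one-to-one on the probability simplex, where mixture densities are regarded as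
densities, that is, up to `lam`-null sets. -/
def Identifiable {Y U : Type*} [MeasurableSpace Y] [Fintype U] (lam : Measure Y)
    (p : Y → U → ℝ) : Prop :=
  ∀ f ∈ stdSimplex ℝ U, ∀ g ∈ stdSimplex ℝ U, mixture p f =ᵐ[lam] mixture p g → f = g

/-- `fstar` is the unique minimizer of `f ↦ K(m, m_f)` over the probability simplex. -/
def IsUniqueKLMinimizer {Y U : Type*} [MeasurableSpace Y] [Fintype U] (lam : Measure Y)
    (p : Y → U → ℝ) (m : Y → ℝ) (fstar : U → ℝ) : Prop :=
  fstar ∈ stdSimplex ℝ U ∧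
    ∀ f ∈ stdSimplex ℝ U, f ≠ fstar → KL lam m (mixture p fstar) < KL lam m (mixture p f)

/-- The predictive recursion `f_0, f_1, f_2, …` along a data sequence `y 1, y 2, …` with weights
`w 1, w 2, …` (the values `y 0` and `w 0` are not used):
`f_i(u) = (1 - w_i) f_{i-1}(u) + w_i p(y_i | u) f_{i-1}(u) / m_{f_{i-1}}(y_i)`. -/
noncomputable def prIter {Y U : Type*} [Fintype U] (p : Y → U → ℝ) (f₀ : U → ℝ) (w : ℕ → ℝ)
    (y : ℕ → Y) : ℕ → U → ℝ
  | 0 => f₀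
  | n + 1 => fun u =>
      (1 - w (n + 1)) * prIter p f₀ w y n u
        + w (n + 1) * p (y (n + 1)) u * prIter p f₀ w y n u
          / mixture p (prIter p f₀ w y n) (y (n + 1))

/-- The Euclidean distance `‖f - g‖` between two vectors indexed by `U`. -/
noncomputable def euclDist {U : Type*} [Fintype U] (f g : U → ℝ) : ℝ :=
  ‖WithLp.toLp 2 (f - g)‖

end PredictiveRecursion

/-! Why the rate holds. Put `μ = law lam m`, and let `q u = p(· | u) / m_fstar` be the component
densities relative to the optimal mixture.

*Reduction.* Finiteness of the divergence at the vertices of the simplex makes every `p(· | u)`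
positive `μ`-almost everywhere, and `K(m, m_f) - K(m, m_fstar)` is the expected log-likelihood ratio
`∫ log (m_fstar / m_f) ∂μ`. So `fstar` is the unique maximizer of the expected log-likelihood
(`isInteriorMaximizer_positiveKernel`). As it is interior, `∫ q u ∂μ = 1` for all `u`, and the `q u`
are linearly independent in `L²(μ)`.

*Noise.* The recursion is a stochastic approximation `f n = f (n - 1) + w n (h (f (n - 1)) + M n)`
with mean field `h = meanField μ p` and bounded martingale differences `M n`. Bounded centred terms
with square summable weights have almost surely convergent sums (`ae_exists_tendsto_sum_centred`).
This is the only use of probability; the rest is an argument about one data sequence.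

*Consistency.* The Lyapunov function is the divergence of `f` from `fstar`. It is infinite on the
boundary, and the ratios `p(y | u) / m_f(y)` are unbounded near it. But the logarithm is increasing,
so in a lower bound for the gain of one step these ratios may be cut off. What is left is a drift
`∫ min (m_fstar / m_f) L ∂μ - 1`, which for a suitable `L` is continuous on the closed simplex and
vanishes at `fstar` only (`exists_truncation`). Hence the divergence converges, the weighted drifts
are summable, the drift is small infinitely often, and the limit of the divergence is its minimum
(`tendsto_prIter`).

*Rate.* In the coordinates `(f u - fstar u) / √(fstar u)` the derivative of `h` at `fstar` is minus
the Gram matrix of the functions `√(fstar u) q u` in `L²(μ)`, which is positive definite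
(`exists_gram_coercive`, `exists_norm_meanField_add_gram_le`). Since `2 (1 - δ) ≥ 1 + ε`, also
`∑ w n ^ (1 - δ) M n` converges. The deviation divided by `w n ^ δ`, plus the tail of this series,
then satisfies a contraction with rates `c w n` and perturbations `o(w n)`, and so tends to zero
(`tendsto_smul_zero_of_linear_recursion`). -/

namespace PredictiveRecursion

/-! ### Weighted sums of centred bounded functions of independent data -/

section Martingale

variable {Ω Y : Type*} [MeasurableSpace Y]

/-- The `σ`-algebra generated by the first `n` observations `Z 0, …, Z (n - 1)`. -/
abbrev history (Z : ℕ → Ω → Y) (n : ℕ) : MeasurableSpace Ω :=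
  MeasurableSpace.comap (fun ω (i : Finset.range n) => Z i ω) MeasurableSpace.pi

lemma measurable_history {Z : ℕ → Ω → Y} {k n : ℕ} (h : k < n) :
    Measurable[history Z n] (Z k) := by
  let g : (Finset.range n → Y) → Y := fun x => x ⟨k, Finset.mem_range.2 h⟩
  have hg : Measurable g := measurable_pi_apply _
  exact hg.comp (comap_measurable (fun ω (i : Finset.range n) => Z i ω))

lemma history_mono (Z : ℕ → Ω → Y) : Monotone (history Z) := by
  intro m n h
  have : Measurable[history Z n] (fun ω (i : Finset.range m) => Z i ω) :=
    @measurable_pi_lambda _ _ _ (history Z n) _ _ fun i =>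
      measurable_history (lt_of_lt_of_le (Finset.mem_range.1 i.2) h)
  exact this.comap_le

variable {E : Type*} [mΩ : MeasurableSpace Ω] [MeasurableSpace E]

lemma history_le {Z : ℕ → Ω → Y} (hZ : ∀ n, Measurable (Z n)) (n : ℕ) :
    history Z n ≤ mΩ :=
  (measurable_pi_lambda (fun ω (i : Finset.range n) => Z i ω) fun i => hZ i).comap_le

/-- The filtration generated by the observations. -/
def historyFiltration (Z : ℕ → Ω → Y) (hZ : ∀ n, Measurable (Z n)) :
    Filtration ℕ mΩ where
  seq := history Z
  mono' := history_mono Z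
  le' := history_le hZ

variable {P : Measure Ω} {μ : Measure Y}

lemma indepFun_of_measurable_history {T : Type*} [MeasurableSpace T] {Z : ℕ → Ω → Y}
    (hZ : ∀ n, Measurable (Z n)) (hind : iIndepFun Z P) {n : ℕ} {G : Ω → T}
    (hG : Measurable[history Z n] G) : IndepFun G (Z n) P := by
  have h1 := hind.indepFun_finset (Finset.range n) {n} (by simp) hZ
  have h2 : IndepFun (fun ω (i : Finset.range n) => Z i ω) (Z n) P :=
    h1.comp measurable_id (measurable_pi_apply (⟨n, by simp⟩ : ({n} : Finset ℕ)))
  rw [IndepFun_iff_Indep] at h2 ⊢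
  exact indep_of_indep_of_le_left h2 hG.comap_le

variable [IsProbabilityMeasure P]

/-- Freezing a variable: an observation independent of the past may be integrated out first. -/
lemma integral_eq_integral_integral_of_indepFun {T : Type*} [MeasurableSpace T] {G : Ω → T}
    {W : Ω → Y} (hG : Measurable G) (hW : Measurable W) (hμ : P.map W = μ)
    (hind : IndepFun G W P) {ψ : T → Y → ℝ} (hψ : Measurable (Function.uncurry ψ))
    (hint : Integrable (fun ω => ψ (G ω) (W ω)) P) :
    ∫ ω, ψ (G ω) (W ω) ∂P = ∫ ω, ∫ y, ψ (G ω) y ∂μ ∂P := by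
  have hμp : IsProbabilityMeasure μ := hμ ▸ Measure.isProbabilityMeasure_map hW.aemeasurable
  have hGp : IsProbabilityMeasure (P.map G) := Measure.isProbabilityMeasure_map hG.aemeasurable
  have hmap := hind.map_prod_eq_prod_map_map hG.aemeasurable hW.aemeasurable
  rw [hμ] at hmap
  have hint' : Integrable (Function.uncurry ψ) ((P.map G).prod μ) := by
    rw [← hmap, integrable_map_measure hψ.aestronglyMeasurable (hG.prodMk hW).aemeasurable]
    exact hint
  have h1 : ∫ ω, ψ (G ω) (W ω) ∂P = ∫ z, Function.uncurry ψ z ∂((P.map G).prod μ) := by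
    rw [← hmap, integral_map (hG.prodMk hW).aemeasurable hψ.aestronglyMeasurable]
    rfl
  rw [h1, integral_prod _ hint', integral_map hG.aemeasurable]
  · rfl
  · exact hint'.aestronglyMeasurable.integral_prod_right'

variable {Z : ℕ → Ω → Y} {F : ℕ → Ω → E} {φ : E → Y → ℝ} {B : ℝ}

lemma integral_mul_centred_eq_zero (hZ : ∀ n, Measurable (Z n)) (hind : iIndepFun Z P)
    (hlaw : ∀ n, P.map (Z n) = μ) (hφ : Measurable (Function.uncurry φ))
    {n : ℕ} {F : Ω → E} (hB : ∀ ω y, |φ (F ω) y| ≤ B) (hF : Measurable[history Z n] F)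
    {S : Ω → ℝ} (hS : Measurable[history Z n] S) {C : ℝ} (hC : ∀ ω, |S ω| ≤ C) :
    ∫ ω, S ω * (φ (F ω) (Z n ω) - ∫ y, φ (F ω) y ∂μ) ∂P = 0 := by
  have hμp : IsProbabilityMeasure μ :=
    hlaw 0 ▸ Measure.isProbabilityMeasure_map (hZ 0).aemeasurable
  have hFm : Measurable F := hF.mono (history_le hZ n) le_rfl
  have hSm : Measurable S := hS.mono (history_le hZ n) le_rfl
  have hint1 : Measurable fun e => ∫ y, φ e y ∂μ :=
    (hφ.stronglyMeasurable.integral_prod_right').measurable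
  have hbar : ∀ ω, |∫ y, φ (F ω) y ∂μ| ≤ B := fun ω => by
    have := norm_integral_le_of_norm_le_const (μ := μ) (f := φ (F ω)) (C := B)
      (Eventually.of_forall fun y => hB ω y)
    simpa using this
  let ψ : ℝ × E → Y → ℝ := fun t y => t.1 * (φ t.2 y - ∫ y, φ t.2 y ∂μ)
  have hψ : Measurable (Function.uncurry ψ) := by
    have h1 : Measurable fun q : (ℝ × E) × Y => φ q.1.2 q.2 :=
      hφ.comp ((measurable_snd.comp measurable_fst).prodMk measurable_snd)
    exact (measurable_fst.comp measurable_fst).mul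
      (h1.sub (hint1.comp (measurable_snd.comp measurable_fst)))
  have hGm : Measurable[history Z n] fun ω => (S ω, F ω) := hS.prodMk hF
  have hGm' : Measurable fun ω => (S ω, F ω) := hSm.prodMk hFm
  have key := integral_eq_integral_integral_of_indepFun hGm' (hZ n) (hlaw n)
    (indepFun_of_measurable_history hZ hind hGm) hψ ?_
  · refine key.trans ?_
    refine integral_eq_zero_of_ae (Eventually.of_forall fun ω => ?_)
    have hi : Integrable (φ (F ω)) μ :=
      Integrable.of_bound (hφ.comp measurable_prodMk_left).aestronglyMeasurable B
        (Eventually.of_forall fun y => hB _ y)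
    simp only [ψ, Pi.zero_apply]
    rw [integral_const_mul, integral_sub hi (integrable_const _)]
    simp
  · refine Integrable.of_bound (hψ.comp (hGm'.prodMk (hZ n))).aestronglyMeasurable
      (C * (B + B)) (Eventually.of_forall fun ω => ?_)
    simp only [ψ, norm_mul, Real.norm_eq_abs]
    have := abs_sub (φ (F ω) (Z n ω)) (∫ y, φ (F ω) y ∂μ)
    have h2 := hB ω (Z n ω)
    have h3 := hbar ω
    exact mul_le_mul (hC ω) (by linarith) (abs_nonneg _) ((abs_nonneg _).trans (hC ω))

/-- If the weights are square summable then the weighted sums of the centred terms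
`φ (F k) (Z k) - ∫ φ (F k) y ∂μ y`, where `F k` depends on the first `k` observations only, form an
`L²`-bounded martingale and so converge almost surely. -/
theorem ae_exists_tendsto_sum_centred (hZ : ∀ n, Measurable (Z n)) (hind : iIndepFun Z P)
    (hlaw : ∀ n, P.map (Z n) = μ) (hφ : Measurable (Function.uncurry φ))
    (hB : ∀ n ω y, |φ (F n ω) y| ≤ B) (hF : ∀ n, Measurable[history Z n] (F n))
    {a : ℕ → ℝ} (ha : Summable fun k => a k ^ 2) :
    ∀ᵐ ω ∂P, ∃ l, Tendsto (fun n => ∑ k ∈ Finset.range n,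
      a k * (φ (F k ω) (Z k ω) - ∫ y, φ (F k ω) y ∂μ)) atTop (𝓝 l) := by
  have hμp : IsProbabilityMeasure μ :=
    hlaw 0 ▸ Measure.isProbabilityMeasure_map (hZ 0).aemeasurable
  have hint1 : Measurable fun e => ∫ y, φ e y ∂μ :=
    (hφ.stronglyMeasurable.integral_prod_right').measurable
  have hbar : ∀ k ω, |∫ y, φ (F k ω) y ∂μ| ≤ B := fun k ω => by
    have := norm_integral_le_of_norm_le_const (μ := μ) (f := φ (F k ω)) (C := B)
      (Eventually.of_forall fun y => hB k ω y)
    simpa using this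
  set ξ : ℕ → Ω → ℝ := fun k ω => φ (F k ω) (Z k ω) - ∫ y, φ (F k ω) y ∂μ with hξ
  set S : ℕ → Ω → ℝ := fun n ω => ∑ k ∈ Finset.range n, a k * ξ k ω with hS
  have hξb : ∀ k ω, |ξ k ω| ≤ 2 * B := fun k ω => by
    have := abs_sub (φ (F k ω) (Z k ω)) (∫ y, φ (F k ω) y ∂μ)
    have h2 := hB k ω (Z k ω)
    have h3 := hbar k ω
    simp only [hξ]; linarith
  have hξm : ∀ k n, k < n → Measurable[history Z n] (ξ k) := fun k n h => by
    have hFk : Measurable[history Z n] (F k) := (hF k).mono (history_mono Z h.le) le_rfl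
    exact (hφ.comp (hFk.prodMk (measurable_history h))).sub (hint1.comp hFk)
  have hSm : ∀ n, Measurable[history Z n] (S n) := fun n =>
    Finset.measurable_fun_sum _ fun k hk =>
      (hξm k n (Finset.mem_range.1 hk)).const_mul (a k)
  have hSm' : ∀ n, Measurable (S n) := fun n => (hSm n).mono (history_le hZ n) le_rfl
  have hξm' : ∀ n, Measurable (ξ n) := fun n =>
    (hξm n (n + 1) n.lt_succ_self).mono (history_le hZ _) le_rfl
  have hSb : ∀ n ω, |S n ω| ≤ ∑ k ∈ Finset.range n, |a k| * (2 * B) := fun n ω =>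
    (Finset.abs_sum_le_sum_abs _ _).trans <| Finset.sum_le_sum fun k _ => by
      rw [abs_mul]; exact mul_le_mul_of_nonneg_left (hξb k ω) (abs_nonneg _)
  have hSsucc : ∀ n ω, S (n + 1) ω = S n ω + a n * ξ n ω := fun n ω =>
    Finset.sum_range_succ _ _
  have hSi : ∀ n, Integrable (S n) P := fun n =>
    Integrable.of_bound (hSm' n).aestronglyMeasurable _ (Eventually.of_forall (hSb n))
  have hξi : ∀ n, Integrable (ξ n) P := fun n =>
    Integrable.of_bound (hξm' n).aestronglyMeasurable _ (Eventually.of_forall (hξb n))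
  have hSξi : ∀ n, Integrable (fun ω => S n ω * ξ n ω) P := fun n => by
    refine Integrable.bdd_mul (hξi n) (hSm' n).aestronglyMeasurable
      (Eventually.of_forall (hSb n))
  have hξ2i : ∀ n, Integrable (fun ω => ξ n ω ^ 2) P := fun n => by
    simp_rw [pow_two]
    exact Integrable.bdd_mul (hξi n) (hξm' n).aestronglyMeasurable
      (Eventually.of_forall (hξb n))
  have hS2i : ∀ n, Integrable (fun ω => S n ω ^ 2) P := fun n => by
    simp_rw [pow_two]
    exact Integrable.bdd_mul (hSi n) (hSm' n).aestronglyMeasurable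
      (Eventually.of_forall (hSb n))
  have horth : ∀ n, ∫ ω, S n ω * ξ n ω ∂P = 0 := fun n =>
    integral_mul_centred_eq_zero hZ hind hlaw hφ (hB n) (hF n) (hSm n) (hSb n)
  have hmart : Martingale S (historyFiltration Z hZ) P := by
    refine martingale_of_setIntegral_eq_succ (fun n => (hSm n).stronglyMeasurable) hSi ?_
    intro n s hs
    have hs' : MeasurableSet s := history_le hZ n s hs
    have hone : Measurable[history Z n] (s.indicator (fun _ : Ω => (1 : ℝ))) :=
      measurable_const.indicator hs
    have h0 := integral_mul_centred_eq_zero hZ hind hlaw hφ (hB n) (hF n) hone (C := 1)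
      (fun ω => by by_cases h : ω ∈ s <;> simp [h])
    have h1 : ∫ ω in s, ξ n ω ∂P = 0 := by
      rw [← integral_indicator hs', ← h0]
      refine integral_congr_ae (Eventually.of_forall fun ω => ?_)
      by_cases h : ω ∈ s <;> simp [h, hξ]
    simp_rw [hSsucc]
    rw [integral_add (hSi n).integrableOn ((hξi n).const_mul _).integrableOn,
      integral_const_mul, h1]
    simp
  have hL2 : ∀ n, ∫ ω, S n ω ^ 2 ∂P ≤ (2 * B) ^ 2 * ∑ k ∈ Finset.range n, a k ^ 2 := by
    intro n
    induction n with
    | zero => simp [hS]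
    | succ n ih =>
      have e1 : ∀ ω, S (n + 1) ω ^ 2
          = S n ω ^ 2 + ((2 * a n) * (S n ω * ξ n ω) + a n ^ 2 * ξ n ω ^ 2) := fun ω => by
        rw [hSsucc]; ring
      have e2 : ∫ ω, ξ n ω ^ 2 ∂P ≤ (2 * B) ^ 2 := by
        have : ∫ ω, ξ n ω ^ 2 ∂P ≤ ∫ _, (2 * B) ^ 2 ∂P :=
          integral_mono (hξ2i n) (integrable_const _) fun ω =>
            sq_le_sq' (abs_le.1 (hξb n ω)).1 (abs_le.1 (hξb n ω)).2
        simpa using this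
      have i1 := (hSξi n).const_mul (2 * a n)
      have i2 := (hξ2i n).const_mul (a n ^ 2)
      have e3 := integral_add (hS2i n) (i1.add i2)
      simp only [Pi.add_apply] at e3
      simp_rw [e1]
      rw [e3, integral_add i1 i2, integral_const_mul, integral_const_mul, horth,
        Finset.sum_range_succ]
      nlinarith [mul_le_mul_of_nonneg_left e2 (sq_nonneg (a n))]
  have hL1 : ∀ n, eLpNorm (S n) 1 P
      ≤ ((1 + (2 * B) ^ 2 * ∑' k, a k ^ 2).toNNReal : ENNReal) := fun n => by
    rw [eLpNorm_one_eq_lintegral_enorm, ← ofReal_integral_norm_eq_lintegral_enorm (hSi n)]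
    refine ENNReal.ofReal_le_ofReal ?_
    have h1 : ∫ ω, ‖S n ω‖ ∂P ≤ ∫ ω, (1 + S n ω ^ 2) ∂P :=
      integral_mono (hSi n).norm ((integrable_const _).add (hS2i n)) fun ω => by
        simp only [Real.norm_eq_abs]
        nlinarith [sq_nonneg (|S n ω| - 1), sq_abs (S n ω)]
    rw [integral_add (integrable_const _) (hS2i n)] at h1
    have h2 := ha.sum_le_tsum (Finset.range n) fun k _ => sq_nonneg (a k)
    have h3 := mul_le_mul_of_nonneg_left h2 (sq_nonneg (2 * B))
    have h4 := hL2 n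
    simp only [integral_const, probReal_univ, smul_eq_mul, mul_one] at h1
    linarith
  filter_upwards [hmart.submartingale.exists_ae_tendsto_of_bdd hL1] with ω hω
  exact hω

end Martingale

/-! ### Divergences as expected log-likelihood ratios -/

section Divergence

variable {Y U : Type*}

/-- The kernel `p`, replaced by `1` at the points where some component vanishes. -/
noncomputable def positiveKernel (p : Y → U → ℝ) (y : Y) (u : U) : ℝ :=
  open scoped Classical in if ∀ v, 0 < p y v then p y u else 1

lemma positiveKernel_of_pos {p : Y → U → ℝ} {y : Y} (h : ∀ v, 0 < p y v) :
    positiveKernel p y = p y := by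
  ext u; rw [positiveKernel, if_pos h]

lemma positiveKernel_pos (p : Y → U → ℝ) (y : Y) (u : U) : 0 < positiveKernel p y u := by
  rw [positiveKernel]; split_ifs with h
  exacts [h u, one_pos]

variable [MeasurableSpace Y] [Fintype U]

lemma IsDensity.isProbabilityMeasure_law {lam : Measure Y} {g : Y → ℝ} (hg : IsDensity lam g) :
    IsProbabilityMeasure (law lam g) :=
  ⟨by rw [law, withDensity_apply _ MeasurableSet.univ, Measure.restrict_univ, hg.lintegral_eq_one]⟩

lemma IsDensity.mixture {lam : Measure Y} {p : Y → U → ℝ}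
    (hp : ∀ u, IsDensity lam (fun y => p y u)) {f : U → ℝ} (hf : f ∈ stdSimplex ℝ U) :
    IsDensity lam (mixture p f) where
  measurable := Finset.measurable_fun_sum _ fun u _ => (hp u).measurable.mul_const _
  nonneg y := Finset.sum_nonneg fun u _ => mul_nonneg ((hp u).nonneg y) (hf.1 u)
  lintegral_eq_one := by
    have h1 : ∀ y, ENNReal.ofReal (PredictiveRecursion.mixture p f y)
        = ∑ u, ENNReal.ofReal (p y u) * ENNReal.ofReal (f u) := fun y => by
      rw [PredictiveRecursion.mixture,
        ENNReal.ofReal_sum_of_nonneg fun u _ => mul_nonneg ((hp u).nonneg y) (hf.1 u)]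
      exact Finset.sum_congr rfl fun u _ => ENNReal.ofReal_mul ((hp u).nonneg y)
    simp_rw [h1]
    rw [lintegral_finsetSum _ fun u _ => (hp u).measurable.ennreal_ofReal.mul_const _]
    simp_rw [lintegral_mul_const _ (hp _).measurable.ennreal_ofReal, (hp _).lintegral_eq_one,
      one_mul]
    rw [← ENNReal.ofReal_sum_of_nonneg fun u _ => hf.1 u, hf.2, ENNReal.ofReal_one]

variable {lam : Measure Y} {m g : Y → ℝ}

lemma ae_pos_of_KL_lt_top (hg : IsDensity lam g) (hfin : KL lam m g < ⊤) :
    ∀ᵐ y ∂(law lam m), 0 < g y := by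
  have hac := (InformationTheory.klDiv_ne_top_iff.1 hfin.ne).1
  refine hac.ae_le (?_ : ∀ᵐ y ∂(law lam g), 0 < g y)
  rw [law, ae_withDensity_iff hg.measurable.ennreal_ofReal]
  exact Eventually.of_forall fun y hy => by simpa using hy

lemma ae_pos_of_forall_KL_lt_top {p : Y → U → ℝ} (hp : ∀ u, IsDensity lam (fun y => p y u))
    (hfin : ∀ f ∈ stdSimplex ℝ U, KL lam m (mixture p f) < ⊤) :
    ∀ᵐ y ∂(law lam m), ∀ u, 0 < p y u := by
  classical
  refine ae_all_iff.2 fun u => ?_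
  -- the vertex of the simplex at `u` gives the component `p(· | u)` itself
  have h := ae_pos_of_KL_lt_top (IsDensity.mixture hp (single_mem_stdSimplex ℝ u))
    (hfin _ (single_mem_stdSimplex ℝ u))
  filter_upwards [h] with y hy
  simpa [mixture, Pi.single_apply] using hy

variable [SigmaFinite lam]

/-- When the divergence is finite it is the expectation of `log (m / g)`, and this expectation
exists. -/
lemma KL_eq_integral_log (hm : IsDensity lam m) (hg : IsDensity lam g) (hfin : KL lam m g < ⊤) :
    Integrable (fun y => Real.log (m y) - Real.log (g y)) (law lam m) ∧
      KL lam m g = ENNReal.ofReal (∫ y, (Real.log (m y) - Real.log (g y)) ∂(law lam m)) ∧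
      0 ≤ ∫ y, (Real.log (m y) - Real.log (g y)) ∂(law lam m) := by
  have hPm := hm.isProbabilityMeasure_law
  have hPg := hg.isProbabilityMeasure_law
  obtain ⟨hac, hint⟩ := InformationTheory.klDiv_ne_top_iff.1 hfin.ne
  have hlam : law lam m ≪ lam := withDensity_absolutelyContinuous _ _
  have e1 := hlam.ae_le (Measure.rnDeriv_mul_rnDeriv (κ := lam) hac)
  have e2 := hlam.ae_le (Measure.rnDeriv_withDensity lam hm.measurable.ennreal_ofReal)
  have e3 := hlam.ae_le (Measure.rnDeriv_withDensity lam hg.measurable.ennreal_ofReal)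
  have hmpos : ∀ᵐ y ∂(law lam m), 0 < m y := by
    rw [law, ae_withDensity_iff hm.measurable.ennreal_ofReal]
    exact Eventually.of_forall fun y hy => by simpa using hy
  have hllr : llr (law lam m) (law lam g)
      =ᵐ[law lam m] fun y => Real.log (m y) - Real.log (g y) := by
    filter_upwards [e1, e2, e3, ae_pos_of_KL_lt_top hg hfin, hmpos] with y h1 h2 h3 hgy hmy
    have h4 : (law lam m).rnDeriv (law lam g) y * ENNReal.ofReal (g y) = ENNReal.ofReal (m y) := by
      rw [← h3, ← h2]; exact h1
    have h5 := congrArg ENNReal.toReal h4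
    rw [ENNReal.toReal_mul, ENNReal.toReal_ofReal hgy.le, ENNReal.toReal_ofReal hmy.le] at h5
    rw [llr, ← Real.log_div hmy.ne' hgy.ne', ← h5, mul_div_cancel_right₀ _ hgy.ne']
  refine ⟨hint.congr hllr, ?_, ?_⟩
  · rw [KL, InformationTheory.klDiv_of_ac_of_integrable hac hint, integral_congr_ae hllr]
    simp
  · have := InformationTheory.integral_llr_add_sub_measure_univ_nonneg hac hint
    rw [integral_congr_ae hllr] at this
    simpa using this

/-- The mixing weights `fstar`, all positive, are the unique maximizer over the simplex of the
expected log-likelihood `f ↦ ∫ log m_f ∂μ`, stated through log-likelihood ratios so that only these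
need be integrable. The kernel is positive everywhere, which costs nothing when it is positive
`μ`-almost everywhere. -/
structure IsInteriorMaximizer (μ : Measure Y) (p : Y → U → ℝ) (fstar : U → ℝ) : Prop where
  measurable : ∀ u, Measurable fun y => p y u
  pos : ∀ y u, 0 < p y u
  mem : fstar ∈ stdSimplex ℝ U
  weight_pos : ∀ u, 0 < fstar u
  integrable : ∀ f ∈ stdSimplex ℝ U,
    Integrable (fun y => Real.log (mixture p fstar y / mixture p f y)) μ
  integral_pos : ∀ f ∈ stdSimplex ℝ U, f ≠ fstar →
    0 < ∫ y, Real.log (mixture p fstar y / mixture p f y) ∂μ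

/-- A unique Kullback-Leibler minimizer in the interior is an interior maximizer of the expected
log-likelihood. -/
lemma isInteriorMaximizer_positiveKernel {p : Y → U → ℝ}
    (hp : ∀ u, IsDensity lam (fun y => p y u)) (hm : IsDensity lam m)
    (hfin : ∀ f ∈ stdSimplex ℝ U, KL lam m (mixture p f) < ⊤)
    {fstar : U → ℝ} (hstar : IsUniqueKLMinimizer lam p m fstar) (hint : ∀ u, 0 < fstar u) :
    IsInteriorMaximizer (law lam m) (positiveKernel p) fstar := by
  have hpos := ae_pos_of_forall_KL_lt_top hp hfin
  have hae : ∀ f ∈ stdSimplex ℝ U,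
      (fun y => (Real.log (m y) - Real.log (mixture p f y))
        - (Real.log (m y) - Real.log (mixture p fstar y))) =ᵐ[law lam m]
      fun y => Real.log (mixture (positiveKernel p) fstar y / mixture (positiveKernel p) f y) := by
    intro f hf
    filter_upwards [hpos, ae_pos_of_KL_lt_top (IsDensity.mixture hp hf) (hfin f hf),
      ae_pos_of_KL_lt_top (IsDensity.mixture hp hstar.1) (hfin _ hstar.1)] with y hy h1 h2
    simp only [mixture, positiveKernel_of_pos hy] at h1 h2 ⊢
    rw [Real.log_div h2.ne' h1.ne']
    ring
  have hk := fun f hf => KL_eq_integral_log hm (IsDensity.mixture hp (f := f) hf) (hfin f hf)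
  refine ⟨fun u => ?_, positiveKernel_pos p, hstar.1, hint, fun f hf => ?_, fun f hf hne => ?_⟩
  · have hs : MeasurableSet {y | ∀ v, 0 < p y v} := by
      rw [Set.ofPred_forall]
      exact MeasurableSet.iInter fun v => measurableSet_lt measurable_const (hp v).measurable
    exact Measurable.ite hs (hp u).measurable measurable_const
  · exact ((hk f hf).1.sub (hk fstar hstar.1).1).congr (hae f hf)
  · have h1 := hk f hf
    have h2 := hk fstar hstar.1
    rw [← integral_congr_ae (hae f hf), integral_sub h1.1 h2.1, sub_pos]
    have h3 := hstar.2 f hf hne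
    rw [h1.2.1, h2.2.1] at h3
    exact (ENNReal.ofReal_lt_ofReal_iff_of_nonneg h2.2.2).1 h3

end Divergence

/-! ### First and second order conditions at the maximizer -/

/-- A second order lower bound for the logarithm. -/
lemma sub_two_mul_sq_le_log {s : ℝ} (hs : -(1 / 2) ≤ s) : s - 2 * s ^ 2 ≤ Real.log (1 + s) := by
  have hpos : 0 < 1 + s := by linarith
  refine le_trans ?_ (Real.one_sub_inv_le_log_of_pos hpos)
  rw [← sub_nonneg]
  have : 1 - (1 + s)⁻¹ - (s - 2 * s ^ 2) = s ^ 2 * (1 + 2 * s) / (1 + s) := by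
    field_simp; ring
  rw [this]
  exact div_nonneg (mul_nonneg (sq_nonneg _) (by linarith)) hpos.le

lemma exists_coercive {E : Type*} [NormedAddCommGroup E] [InnerProductSpace ℝ E]
    [FiniteDimensional ℝ E] (T : E →L[ℝ] E) (hT : ∀ x, x ≠ 0 → 0 < inner ℝ x (T x)) :
    ∃ c > 0, ∀ x, c * ‖x‖ ^ 2 ≤ inner ℝ x (T x) := by
  rcases subsingleton_or_nontrivial E with hE | hE
  · exact ⟨1, one_pos, fun x => by simp [Subsingleton.elim x 0]⟩
  have hcont : Continuous fun x => inner ℝ x (T x) := by fun_prop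
  obtain ⟨x₀, hx₀, hmin⟩ := (isCompact_sphere (0 : E) 1).exists_isMinOn
    (NormedSpace.sphere_nonempty.2 zero_le_one) hcont.continuousOn
  have hx₀' : ‖x₀‖ = 1 := by simpa using hx₀
  refine ⟨inner ℝ x₀ (T x₀), hT x₀ (by rintro rfl; simp at hx₀'), fun x => ?_⟩
  rcases eq_or_ne x 0 with rfl | hx
  · simp
  have hn : ‖x‖ ≠ 0 := norm_ne_zero_iff.2 hx
  have h1 : inner ℝ x₀ (T x₀) ≤ inner ℝ (‖x‖⁻¹ • x) (T (‖x‖⁻¹ • x)) :=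
    hmin (by simp [norm_smul, hn])
  rw [map_smul, real_inner_smul_left, real_inner_smul_right] at h1
  calc inner ℝ x₀ (T x₀) * ‖x‖ ^ 2
      ≤ (‖x‖⁻¹ * (‖x‖⁻¹ * inner ℝ x (T x))) * ‖x‖ ^ 2 := by gcongr
    _ = inner ℝ x (T x) := by field_simp

section Static

variable {Y U : Type*} [Fintype U]

/-- The density of the component `u` relative to the mixture `m_f`. -/
noncomputable def relDensity (p : Y → U → ℝ) (f : U → ℝ) (u : U) (y : Y) : ℝ :=
  p y u / mixture p f y

variable {p : Y → U → ℝ} {f : U → ℝ}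

lemma mixture_pos (hp : ∀ y u, 0 < p y u) (hf : f ∈ stdSimplex ℝ U) (y : Y) :
    0 < mixture p f y := by
  refine Finset.sum_pos' (fun u _ => mul_nonneg (hp y u).le (hf.1 u)) ?_
  by_contra! h
  have : ∑ u, f u ≤ 0 := Finset.sum_nonpos fun u _ => by
    by_contra! hu
    exact absurd (h u (Finset.mem_univ u)) (not_le.2 (mul_pos (hp y u) hu))
  linarith [hf.2]

lemma relDensity_pos (hp : ∀ y u, 0 < p y u) (hf : f ∈ stdSimplex ℝ U) (u : U) (y : Y) :
    0 < relDensity p f u y := div_pos (hp y u) (mixture_pos hp hf y)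

lemma sum_relDensity_mul (f g : U → ℝ) (y : Y) :
    ∑ u, relDensity p f u y * g u = mixture p g y / mixture p f y := by
  simp only [relDensity, mixture, Finset.sum_div, div_mul_eq_mul_div]

lemma relDensity_mul_le_one (hp : ∀ y u, 0 < p y u) (hf : f ∈ stdSimplex ℝ U) (u : U) (y : Y) :
    relDensity p f u y * f u ≤ 1 := by
  have h := sum_relDensity_mul f f y (p := p)
  rw [div_self (mixture_pos hp hf y).ne'] at h
  rw [← h]
  exact Finset.single_le_sum (f := fun u => relDensity p f u y * f u)
    (fun v _ => mul_nonneg (relDensity_pos hp hf v y).le (hf.1 v)) (Finset.mem_univ u)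

variable [MeasurableSpace Y]

lemma measurable_mixture (hp : ∀ u, Measurable fun y => p y u) (f : U → ℝ) :
    Measurable (mixture p f) :=
  Finset.measurable_fun_sum _ fun u _ => (hp u).mul_const _

lemma measurable_relDensity (hp : ∀ u, Measurable fun y => p y u) (f : U → ℝ) (u : U) :
    Measurable (relDensity p f u) := (hp u).div (measurable_mixture hp f)

variable {μ : Measure Y} [IsProbabilityMeasure μ] {fstar : U → ℝ}

lemma integrable_of_abs_le {g : Y → ℝ} (hg : Measurable g) {C : ℝ} (h : ∀ y, |g y| ≤ C) :
    Integrable g μ :=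
  Integrable.of_bound hg.aestronglyMeasurable C (Eventually.of_forall h)

namespace IsInteriorMaximizer

variable (h : IsInteriorMaximizer μ p fstar)
include h

omit [IsProbabilityMeasure μ] in
lemma relDensity_le (u : U) (y : Y) : relDensity p fstar u y ≤ (fstar u)⁻¹ := by
  have := relDensity_mul_le_one h.pos h.mem u y
  rwa [← one_div, le_div_iff₀ (h.weight_pos u)]

omit [IsProbabilityMeasure μ] in
lemma abs_relDensity_le (u : U) (y : Y) : |relDensity p fstar u y| ≤ (fstar u)⁻¹ := by
  rw [abs_of_pos (relDensity_pos h.pos h.mem u y)]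
  exact h.relDensity_le u y

lemma integrable_relDensity (u : U) : Integrable (relDensity p fstar u) μ :=
  integrable_of_abs_le (measurable_relDensity h.measurable _ u) (h.abs_relDensity_le u)

omit [IsProbabilityMeasure μ] in
lemma integral_log_nonneg (hf : f ∈ stdSimplex ℝ U) :
    0 ≤ ∫ y, Real.log (mixture p fstar y / mixture p f y) ∂μ := by
  rcases eq_or_ne f fstar with rfl | hne
  · refine integral_nonneg fun y => ?_
    simp [div_self (mixture_pos h.pos hf y).ne']
  · exact (h.integral_pos f hf hne).le

lemma integral_relDensity_le_one (u : U) : ∫ y, relDensity p fstar u y ∂μ ≤ 1 := by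
  classical
  set q := relDensity p fstar u with hq
  set C := 2 * (1 + (fstar u)⁻¹) ^ 2 with hC
  have hqi := h.integrable_relDensity u
  -- move from `fstar` a fraction `t` of the way towards the vertex at `u`
  have key : ∀ t ∈ Set.Ioc (0 : ℝ) (1 / 2), ∫ y, q y ∂μ - 1 ≤ t * C := by
    intro t ht
    set f : U → ℝ := (1 - t) • fstar + t • Pi.single u 1 with hf
    have hfm : f ∈ stdSimplex ℝ U :=
      (convex_stdSimplex ℝ U) h.mem (single_mem_stdSimplex ℝ u) (by linarith [ht.2]) ht.1.le
        (by ring)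
    have hmix : ∀ y, mixture p f y = mixture p fstar y * (1 + t * (q y - 1)) := by
      intro y
      have h1 : mixture p f y = (1 - t) * mixture p fstar y + t * p y u := by
        simp only [mixture, hf, Pi.add_apply, Pi.smul_apply, smul_eq_mul, mul_add,
          Finset.sum_add_distrib, Finset.mul_sum]
        congr 1
        · exact Finset.sum_congr rfl fun v _ => by ring
        · simp [Pi.single_apply, mul_comm]
      have h2 : mixture p fstar y * q y = p y u :=
        mul_div_cancel₀ _ (mixture_pos h.pos h.mem y).ne'
      rw [h1, ← h2]; ring
    have hlow : ∀ y, Real.log (mixture p fstar y / mixture p f y)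
        ≤ t ^ 2 * C - t * (q y - 1) := by
      intro y
      have hm := mixture_pos h.pos h.mem y
      have hq0 := relDensity_pos h.pos h.mem u y
      have hq1 := h.relDensity_le u y
      have hs : -(1 / 2) ≤ t * (q y - 1) := by
        have : 0 ≤ t * q y := mul_nonneg ht.1.le hq0.le
        linarith [ht.2]
      have h1 := sub_two_mul_sq_le_log hs
      have h2 : mixture p fstar y / mixture p f y = (1 + t * (q y - 1))⁻¹ := by
        rw [hmix, ← div_div, div_self hm.ne', one_div]
      rw [h2, Real.log_inv]
      have h3 : (q y - 1) ^ 2 ≤ (1 + (fstar u)⁻¹) ^ 2 :=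
        sq_le_sq' (by linarith [inv_pos.2 (h.weight_pos u)]) (by linarith)
      have h4 := mul_le_mul_of_nonneg_left h3 (sq_nonneg t)
      nlinarith
    have hi1 : Integrable (fun y => t * (q y - 1)) μ :=
      (hqi.sub (integrable_const _)).const_mul _
    have hi : Integrable (fun y => t ^ 2 * C - t * (q y - 1)) μ := (integrable_const _).sub hi1
    have h5 := (h.integral_log_nonneg hfm).trans (integral_mono (h.integrable f hfm) hi hlow)
    have e : ∫ y, t * (q y - 1) ∂μ = t * (∫ y, q y ∂μ - 1) := by
      rw [integral_const_mul, integral_sub hqi (integrable_const _)]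
      simp [hq]
    rw [integral_sub (integrable_const _) hi1, e] at h5
    simp only [integral_const, probReal_univ, smul_eq_mul, one_mul] at h5
    have h6 : t * (∫ y, q y ∂μ - 1) ≤ t * (t * C) := by nlinarith
    exact le_of_mul_le_mul_left h6 ht.1
  have hlim : Tendsto (fun t : ℝ => t * C) (𝓝[>] 0) (𝓝 0) := by
    have : Tendsto (fun t : ℝ => t * C) (𝓝 0) (𝓝 (0 * C)) := tendsto_id.mul_const C
    rw [zero_mul] at this
    exact this.mono_left nhdsWithin_le_nhds
  have := ge_of_tendsto hlim (by
    filter_upwards [Ioc_mem_nhdsGT (show (0 : ℝ) < 1 / 2 by norm_num)] with t ht using key t ht)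
  linarith

/-- The first order condition at an interior maximizer. -/
lemma integral_relDensity (u : U) : ∫ y, relDensity p fstar u y ∂μ = 1 := by
  have hsum : ∑ u, fstar u * (1 - ∫ y, relDensity p fstar u y ∂μ) = 0 := by
    have h1 : ∑ u, (∫ y, relDensity p fstar u y ∂μ) * fstar u = 1 := by
      simp_rw [← integral_mul_const]
      rw [← integral_finsetSum _ fun u _ => (h.integrable_relDensity u).mul_const _]
      simp_rw [sum_relDensity_mul fstar fstar, div_self (mixture_pos h.pos h.mem _).ne']
      simp
    simp_rw [mul_sub, mul_one]
    rw [Finset.sum_sub_distrib, h.mem.2]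
    simp_rw [mul_comm (fstar _)]
    rw [h1, sub_self]
  have h0 := (Finset.sum_eq_zero_iff_of_nonneg fun v _ => mul_nonneg (h.weight_pos v).le
    (sub_nonneg.2 (h.integral_relDensity_le_one v))).1 hsum u (Finset.mem_univ u)
  rcases mul_eq_zero.1 h0 with h1 | h1
  · exact absurd h1 (h.weight_pos u).ne'
  · linarith

/-- The second order condition: no nontrivial combination of the relative densities vanishes,
for else moving `fstar` along it would leave the mixture unchanged `μ`-almost everywhere. -/
lemma eq_zero_of_sum_relDensity_ae_eq_zero {a : U → ℝ}
    (ha : ∀ᵐ y ∂μ, ∑ u, a u * relDensity p fstar u y = 0) : a = 0 := by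
  -- by the first order condition the combination has total mass zero
  have hsum : ∑ u, a u = 0 := by
    have h1 := integral_eq_zero_of_ae (μ := μ) ha
    rw [integral_finsetSum _ fun u _ => (h.integrable_relDensity u).const_mul _] at h1
    simpa [integral_const_mul, h.integral_relDensity] using h1
  have hev : ∀ᶠ t : ℝ in 𝓝[>] 0, ∀ u, 0 < fstar u + t * a u := by
    refine eventually_all.2 fun u => ?_
    have : Tendsto (fun t : ℝ => fstar u + t * a u) (𝓝 0) (𝓝 (fstar u + 0 * a u)) :=
      (tendsto_id.mul_const _).const_add _
    rw [zero_mul, add_zero] at this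
    exact (this.mono_left nhdsWithin_le_nhds).eventually_const_lt (h.weight_pos u)
  obtain ⟨t, ht, ht0⟩ := (hev.and self_mem_nhdsWithin).exists
  have ht0' : t ≠ 0 := ne_of_gt ht0
  by_contra hne
  have hfm : (fun u => fstar u + t * a u) ∈ stdSimplex ℝ U :=
    ⟨fun u => (ht u).le, by
      rw [Finset.sum_add_distrib, ← Finset.mul_sum, hsum, h.mem.2]; ring⟩
  have hne' : (fun u => fstar u + t * a u) ≠ fstar := by
    intro he
    apply hne
    ext u
    have := congrFun he u
    simp only [add_eq_left, mul_eq_zero, ht0', false_or] at this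
    simpa using this
  refine absurd (h.integral_pos _ hfm hne') (not_lt.2 (le_of_eq ?_))
  refine integral_eq_zero_of_ae ?_
  filter_upwards [ha] with y hy
  have hm := mixture_pos h.pos h.mem y
  have h1 : ∑ u, p y u * a u = 0 := by
    have h2 : ∑ u, p y u * a u = mixture p fstar y * ∑ u, a u * relDensity p fstar u y := by
      rw [Finset.mul_sum]
      refine Finset.sum_congr rfl fun u _ => ?_
      rw [relDensity]; field_simp
    rw [h2, hy, mul_zero]
  have h3 : mixture p (fun u => fstar u + t * a u) y = mixture p fstar y := by
    have : ∑ u, p y u * (fstar u + t * a u) = ∑ u, p y u * fstar u + t * ∑ u, p y u * a u := by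
      rw [Finset.mul_sum, ← Finset.sum_add_distrib]
      exact Finset.sum_congr rfl fun u _ => by ring
    rw [mixture, this, h1, mixture]; ring
  simp [h3, div_self hm.ne']

end IsInteriorMaximizer

end Static

/-! ### Linearization of the mean field at the maximizer -/

section Linearization

variable {Y U : Type*} [Fintype U]

/-- The component densities relative to `m_fstar`, scaled by `√fstar`. -/
noncomputable def score (p : Y → U → ℝ) (fstar : U → ℝ) (u : U) (y : Y) : ℝ :=
  √(fstar u) * relDensity p fstar u y

/-- The deviation from `fstar` in the coordinates `(f u - fstar u) / √(fstar u)`, in which the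
Euclidean norm is the chi-square distance and the linearized mean field is symmetric. -/
noncomputable def deviation (fstar f : U → ℝ) : EuclideanSpace ℝ U :=
  WithLp.toLp 2 fun u => (f u - fstar u) / √(fstar u)

variable [MeasurableSpace Y]

/-- The Gram matrix of the scores in `L²(μ)`, as an operator. It is the negative of the derivative
of the mean field at `fstar`, in the coordinates of `deviation`. -/
noncomputable def gram (μ : Measure Y) (p : Y → U → ℝ) (fstar : U → ℝ) :
    EuclideanSpace ℝ U →L[ℝ] EuclideanSpace ℝ U :=
  open scoped Classical in
  Matrix.toEuclideanCLM (n := U) (𝕜 := ℝ)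
    (Matrix.of fun u v => ∫ y, score p fstar u y * score p fstar v y ∂μ)

/-- The mean field of the recursion: the expected increment of `f` for unit weight. -/
noncomputable def meanField (μ : Measure Y) (p : Y → U → ℝ) (f : U → ℝ) (u : U) : ℝ :=
  ∫ y, relDensity p f u y * f u ∂μ - f u

namespace IsInteriorMaximizer

variable {p : Y → U → ℝ} {μ : Measure Y} [IsProbabilityMeasure μ] {fstar : U → ℝ}
variable (h : IsInteriorMaximizer μ p fstar)
include h

omit [IsProbabilityMeasure μ] in
lemma measurable_score (u : U) : Measurable (score p fstar u) :=
  (measurable_relDensity h.measurable _ u).const_mul _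

omit [IsProbabilityMeasure μ] in
lemma abs_score_le (u : U) (y : Y) : |score p fstar u y| ≤ (√(fstar u))⁻¹ := by
  have hs := Real.sqrt_pos.2 (h.weight_pos u)
  rw [score, abs_mul, abs_of_pos hs]
  calc √(fstar u) * |relDensity p fstar u y| ≤ √(fstar u) * (fstar u)⁻¹ := by
        gcongr; exact h.abs_relDensity_le u y
    _ = (√(fstar u))⁻¹ := by
        nth_rw 2 [← Real.mul_self_sqrt (h.weight_pos u).le]
        field_simp

lemma integrable_score_mul_score (u v : U) :
    Integrable (fun y => score p fstar u y * score p fstar v y) μ :=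
  integrable_of_abs_le ((h.measurable_score u).mul (h.measurable_score v))
    (C := (√(fstar u))⁻¹ * (√(fstar v))⁻¹) fun y => by
      rw [abs_mul]
      exact mul_le_mul (h.abs_score_le u y) (h.abs_score_le v y) (abs_nonneg _)
        (inv_nonneg.2 (Real.sqrt_nonneg _))

lemma gram_apply (x : EuclideanSpace ℝ U) (u : U) :
    gram μ p fstar x u = ∫ y, score p fstar u y * ∑ v, score p fstar v y * x v ∂μ := by
  classical
  have h1 : gram μ p fstar x u
      = ∑ v, (∫ y, score p fstar u y * score p fstar v y ∂μ) * x v := by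
    rw [gram, Matrix.ofLp_toEuclideanCLM]
    rfl
  rw [h1]
  simp_rw [← integral_mul_const, Finset.mul_sum, ← mul_assoc]
  rw [integral_finsetSum _ fun v _ => (h.integrable_score_mul_score u v).mul_const _]

lemma inner_gram (x : EuclideanSpace ℝ U) :
    inner ℝ x (gram μ p fstar x) = ∫ y, (∑ v, score p fstar v y * x v) ^ 2 ∂μ := by
  have hi : ∀ u, Integrable (fun y => score p fstar u y * ∑ v, score p fstar v y * x v) μ := by
    intro u
    simp_rw [Finset.mul_sum, ← mul_assoc]
    exact integrable_finsetSum _ fun v _ => (h.integrable_score_mul_score u v).mul_const _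
  have h1 : inner ℝ x (gram μ p fstar x) = ∑ u, gram μ p fstar x u * x u := by
    rw [PiLp.inner_apply]
    rfl
  rw [h1]
  simp_rw [h.gram_apply, ← integral_mul_const]
  rw [← integral_finsetSum _ fun u _ => (hi u).mul_const _]
  refine integral_congr_ae (Eventually.of_forall fun y => ?_)
  simp only [pow_two]
  rw [Finset.sum_mul]
  exact Finset.sum_congr rfl fun u _ => by ring

lemma exists_gram_coercive :
    ∃ c > 0, ∀ x, c * ‖x‖ ^ 2 ≤ inner ℝ x (gram μ p fstar x) := by
  refine exists_coercive _ fun x hx => ?_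
  rw [h.inner_gram]
  have hnn : ∀ y, 0 ≤ (∑ v, score p fstar v y * x v) ^ 2 := fun y => sq_nonneg _
  have hi : Integrable (fun y => (∑ v, score p fstar v y * x v) ^ 2) μ := by
    simp_rw [pow_two, Finset.sum_mul_sum]
    refine integrable_finsetSum _ fun u _ => integrable_finsetSum _ fun v _ => ?_
    exact ((h.integrable_score_mul_score u v).mul_const (x u * x v)).congr
      (Eventually.of_forall fun y => by simp only; ring)
  refine (integral_nonneg hnn).lt_of_ne fun h0 => hx ?_
  have hae := (integral_eq_zero_iff_of_nonneg hnn hi).1 h0.symm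
  have ha : (fun u => √(fstar u) * x u) = 0 := by
    refine h.eq_zero_of_sum_relDensity_ae_eq_zero ?_
    filter_upwards [hae] with y hy
    refine Eq.trans (Finset.sum_congr rfl fun u _ => ?_)
      ((pow_eq_zero_iff two_ne_zero).1 hy)
    rw [score]; ring
  ext u
  have := congrFun ha u
  simpa [(Real.sqrt_pos.2 (h.weight_pos u)).ne'] using this

/-- Near `fstar` the mean field is `-gram`, up to a quadratic error. -/
theorem exists_norm_meanField_add_gram_le :
    ∃ C r : ℝ, 0 ≤ C ∧ 0 < r ∧ ∀ f ∈ stdSimplex ℝ U, ‖deviation fstar f‖ ≤ r →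
      ‖WithLp.toLp 2 (fun u => meanField μ p f u / √(fstar u))
        + gram μ p fstar (deviation fstar f)‖ ≤ C * ‖deviation fstar f‖ ^ 2 := by
  set K : ℝ := 1 + ∑ v, (√(fstar v))⁻¹ with hK
  have hKs : ∀ u, (√(fstar u))⁻¹ ≤ K := fun u => by
    have := Finset.single_le_sum (f := fun v => (√(fstar v))⁻¹)
      (fun v _ => inv_nonneg.2 (Real.sqrt_nonneg _)) (Finset.mem_univ u)
    rw [hK]; linarith
  have hK1 : 1 ≤ K := le_add_of_nonneg_right
    (Finset.sum_nonneg fun v _ => inv_nonneg.2 (Real.sqrt_nonneg _))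
  refine ⟨√(Fintype.card U) * (5 * K ^ 4), (2 * K)⁻¹, by positivity, by positivity,
    fun f hf hr => ?_⟩
  set x := deviation fstar f with hx
  set N := ‖x‖ with hN
  have hN0 : 0 ≤ N := norm_nonneg _
  have hxN : ∀ v, |x v| ≤ N := fun v => PiLp.norm_apply_le x v
  have hKN : K * N ≤ 1 / 2 := by
    calc K * N ≤ K * (2 * K)⁻¹ := by gcongr
      _ = 1 / 2 := by field_simp
  have hN1 : N ≤ 1 := by nlinarith
  -- `t` is the relative perturbation `m_f / m_fstar - 1` of the mixture
  set t : Y → ℝ := fun y => ∑ v, score p fstar v y * x v with ht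
  have htm : Measurable t :=
    Finset.measurable_fun_sum _ fun v _ => (h.measurable_score v).mul_const _
  have htb : ∀ y, |t y| ≤ K * N := fun y => by
    calc |t y| ≤ ∑ v, |score p fstar v y * x v| := Finset.abs_sum_le_sum_abs _ _
      _ ≤ ∑ v, (√(fstar v))⁻¹ * N := by
          refine Finset.sum_le_sum fun v _ => ?_
          rw [abs_mul]
          exact mul_le_mul (h.abs_score_le v y) (hxN v) (abs_nonneg _)
            (inv_nonneg.2 (Real.sqrt_nonneg _))
      _ ≤ K * N := by
          rw [← Finset.sum_mul]
          gcongr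
          rw [hK]; linarith
  have htmix : ∀ y, mixture p f y = mixture p fstar y * (1 + t y) := fun y => by
    have h1 : t y = ∑ v, relDensity p fstar v y * (f v - fstar v) := by
      refine Finset.sum_congr rfl fun v _ => ?_
      have := (Real.sqrt_pos.2 (h.weight_pos v)).ne'
      simp only [hx, deviation, score]
      field_simp
    have h2 := mixture_pos h.pos h.mem y
    simp_rw [h1, mul_sub, Finset.sum_sub_distrib, sum_relDensity_mul]
    field_simp
    ring
  have hcomp : ∀ u, |meanField μ p f u / √(fstar u) + gram μ p fstar x u|
      ≤ 5 * K ^ 4 * N ^ 2 := by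
    intro u
    set q := relDensity p fstar u with hq
    set s := √(fstar u) with hs
    have hs0 : 0 < s := Real.sqrt_pos.2 (h.weight_pos u)
    have hs2 : s * s = fstar u := Real.mul_self_sqrt (h.weight_pos u).le
    have hfle : fstar u ≤ 1 := by
      rw [← h.mem.2]
      exact Finset.single_le_sum (fun v _ => h.mem.1 v) (Finset.mem_univ u)
    have hs1 : s ≤ 1 := Real.sqrt_le_one.2 hfle
    have hq0 : ∀ y, 0 < q y := relDensity_pos h.pos h.mem u
    have hqK : ∀ y, q y ≤ K ^ 2 := fun y => by
      refine (h.relDensity_le u y).trans ?_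
      rw [← hs2, mul_inv, pow_two]
      exact mul_le_mul (hKs u) (hKs u) (inv_nonneg.2 hs0.le) (by linarith)
    have hqi := h.integrable_relDensity u
    have hqtb : ∀ y, |q y * t y| ≤ K ^ 2 * (K * N) := fun y => by
      rw [abs_mul, abs_of_pos (hq0 y)]
      exact mul_le_mul (hqK y) (htb y) (abs_nonneg _) (by positivity)
    have hqti : Integrable (fun y => q y * t y) μ :=
      integrable_of_abs_le ((measurable_relDensity h.measurable _ u).mul htm) hqtb
    set A := ∫ y, q y * t y ∂μ with hA
    have hAb : |A| ≤ K ^ 2 * (K * N) := by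
      simpa using norm_integral_le_of_norm_le_const (μ := μ) (f := fun y => q y * t y)
        (Eventually.of_forall hqtb)
    have hrel : ∀ y, |relDensity p f u y - (q y - q y * t y)| ≤ K ^ 2 * (2 * (K * N) ^ 2) := by
      intro y
      have h1 := abs_le.1 (htb y)
      have h2 : 1 / 2 ≤ 1 + t y := by linarith
      have h3 : relDensity p f u y = q y / (1 + t y) := by
        rw [relDensity, htmix, ← div_div]; rfl
      have h4 : relDensity p f u y - (q y - q y * t y) = q y * (t y ^ 2 / (1 + t y)) := by
        rw [h3]
        have : 1 + t y ≠ 0 := by linarith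
        field_simp
        ring
      have h5 : t y ^ 2 / (1 + t y) ≤ 2 * (K * N) ^ 2 := by
        rw [div_le_iff₀ (by linarith)]
        have h6 : t y ^ 2 ≤ (K * N) ^ 2 := sq_le_sq' h1.1 h1.2
        nlinarith [sq_nonneg (K * N)]
      rw [h4, abs_of_nonneg (mul_nonneg (hq0 y).le (div_nonneg (sq_nonneg _) (by linarith)))]
      exact mul_le_mul (hqK y) h5 (div_nonneg (sq_nonneg _) (by linarith)) (by positivity)
    have hlin : ∫ y, (q y - q y * t y) ∂μ = 1 - A := by
      rw [integral_sub hqi hqti, h.integral_relDensity]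
    have hdi : Integrable (fun y => relDensity p f u y - (q y - q y * t y)) μ :=
      integrable_of_abs_le ((measurable_relDensity h.measurable _ u).sub
        ((measurable_relDensity h.measurable _ u).sub
          ((measurable_relDensity h.measurable _ u).mul htm))) hrel
    set ρ := ∫ y, (relDensity p f u y - (q y - q y * t y)) ∂μ with hρ
    have hρb : |ρ| ≤ K ^ 2 * (2 * (K * N) ^ 2) := by
      simpa using norm_integral_le_of_norm_le_const (μ := μ)
        (f := fun y => relDensity p f u y - (q y - q y * t y)) (Eventually.of_forall hrel)
    have hint : ∫ y, relDensity p f u y ∂μ = ρ + (1 - A) := by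
      have hqqt : Integrable (fun y => q y - q y * t y) μ := hqi.sub hqti
      rw [hρ, ← hlin, ← integral_add hdi hqqt]
      simp
    have hgr : gram μ p fstar x u = s * A := by
      rw [h.gram_apply, hA, ← integral_const_mul]
      refine integral_congr_ae (Eventually.of_forall fun y => ?_)
      simp only [score, hq, hs, ht]; ring
    have hfu : f u = s * s + s * x u := by
      simp only [hx, deviation, ← hs, hs2]
      field_simp
      ring
    have hmf : meanField μ p f u / s = (s + x u) * (ρ - A) := by
      rw [meanField, integral_mul_const, hint, hfu]
      field_simp
      ring
    have hfin : meanField μ p f u / s + gram μ p fstar x u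
        = (s + x u) * ρ - x u * A := by rw [hmf, hgr]; ring
    rw [hfin]
    have e1 : |(s + x u) * ρ| ≤ 2 * (K ^ 2 * (2 * (K * N) ^ 2)) := by
      rw [abs_mul]
      refine mul_le_mul ?_ hρb (abs_nonneg _) (by norm_num)
      refine (abs_add_le _ _).trans ?_
      rw [abs_of_pos hs0]
      linarith [hxN u]
    have e2 : |x u * A| ≤ N * (K ^ 2 * (K * N)) := by
      rw [abs_mul]
      exact mul_le_mul (hxN u) hAb (abs_nonneg _) hN0
    have e3 : K ^ 3 * N ^ 2 ≤ K ^ 4 * N ^ 2 := by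
      gcongr
      norm_num
    calc |(s + x u) * ρ - x u * A| ≤ |(s + x u) * ρ| + |x u * A| := abs_sub _ _
      _ ≤ 2 * (K ^ 2 * (2 * (K * N) ^ 2)) + N * (K ^ 2 * (K * N)) := add_le_add e1 e2
      _ = 4 * (K ^ 4 * N ^ 2) + K ^ 3 * N ^ 2 := by ring
      _ ≤ 5 * K ^ 4 * N ^ 2 := by linarith
  rw [EuclideanSpace.norm_eq]
  have hD : 0 ≤ 5 * K ^ 4 * N ^ 2 := by positivity
  calc _ ≤ √(∑ _u : U, (5 * K ^ 4 * N ^ 2) ^ 2) := by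
        refine Real.sqrt_le_sqrt (Finset.sum_le_sum fun u _ => ?_)
        exact pow_le_pow_left₀ (norm_nonneg _) (hcomp u) 2
    _ = √(Fintype.card U) * (5 * K ^ 4) * N ^ 2 := by
        rw [Finset.sum_const, nsmul_eq_mul, Real.sqrt_mul (Nat.cast_nonneg _),
          Real.sqrt_sq hD, Finset.card_univ]
        ring

end IsInteriorMaximizer

end Linearization

/-! ### The truncated drift of the Kullback-Leibler Lyapunov function -/

section Excess

variable {Y U : Type*} [Fintype U]

/-- The ratio `m_fstar / m_f`, truncated at `L`. Truncation keeps it bounded where some weight of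
`f` is small. -/
noncomputable def truncRatio (p : Y → U → ℝ) (fstar : U → ℝ) (L : ℝ) (f : U → ℝ) (y : Y) : ℝ :=
  min (mixture p fstar y / mixture p f y) L

namespace IsInteriorMaximizer

variable [MeasurableSpace Y] {p : Y → U → ℝ} {μ : Measure Y} [IsProbabilityMeasure μ]
  {fstar : U → ℝ} (h : IsInteriorMaximizer μ p fstar)
include h

omit [IsProbabilityMeasure μ] in
lemma ratio_pos {f : U → ℝ} (hf : f ∈ stdSimplex ℝ U) (y : Y) :
    0 < mixture p fstar y / mixture p f y :=
  div_pos (mixture_pos h.pos h.mem y) (mixture_pos h.pos hf y)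

omit [IsProbabilityMeasure μ] in
lemma abs_truncRatio_le {L : ℝ} (hL : 0 ≤ L) {f : U → ℝ} (hf : f ∈ stdSimplex ℝ U) (y : Y) :
    |truncRatio p fstar L f y| ≤ L := by
  rw [truncRatio, abs_of_nonneg (le_min (h.ratio_pos hf y).le hL)]
  exact min_le_right _ _

omit [IsProbabilityMeasure μ] in
lemma measurable_truncRatio (L : ℝ) (f : U → ℝ) : Measurable (truncRatio p fstar L f) :=
  ((measurable_mixture h.measurable _).div (measurable_mixture h.measurable _)).min
    measurable_const

lemma integrable_truncRatio {L : ℝ} (hL : 0 ≤ L) {f : U → ℝ} (hf : f ∈ stdSimplex ℝ U) :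
    Integrable (truncRatio p fstar L f) μ :=
  integrable_of_abs_le (h.measurable_truncRatio L f) (h.abs_truncRatio_le hL hf)

lemma continuousOn_integral_truncRatio {L : ℝ} (hL : 0 ≤ L) :
    ContinuousOn (fun f => ∫ y, truncRatio p fstar L f y ∂μ) (stdSimplex ℝ U) := by
  refine continuousOn_of_dominated (bound := fun _ => L)
    (fun f _ => (h.measurable_truncRatio L f).aestronglyMeasurable)
    (fun f hf => Eventually.of_forall fun y => h.abs_truncRatio_le hL hf y)
    (integrable_const _) (Eventually.of_forall fun y => ?_)
  have hc : Continuous fun f : U → ℝ => mixture p f y := by unfold mixture; fun_prop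
  have hd : ContinuousOn (fun f => mixture p fstar y / mixture p f y) (stdSimplex ℝ U) :=
    continuousOn_const.div hc.continuousOn fun f hf => (mixture_pos h.pos hf y).ne'
  exact hd.inf continuousOn_const

lemma integral_truncRatio_mono {L L' : ℝ} (hL : 0 ≤ L) (hLL : L ≤ L') {f : U → ℝ}
    (hf : f ∈ stdSimplex ℝ U) :
    ∫ y, truncRatio p fstar L f y ∂μ ≤ ∫ y, truncRatio p fstar L' f y ∂μ :=
  integral_mono (h.integrable_truncRatio hL hf) (h.integrable_truncRatio (hL.trans hLL) hf)
    fun _ => min_le_min_left _ hLL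

/-- Away from `fstar` the expectation of `m_fstar / m_f` exceeds one, and already does so after
truncation at a high level: `x - 1 ≥ log x`, and `∫ log (m_fstar / m_f) ∂μ` is positive. -/
lemma exists_one_lt_integral_truncRatio {f : U → ℝ} (hf : f ∈ stdSimplex ℝ U) (hne : f ≠ fstar) :
    ∃ n : ℕ, 1 < ∫ y, truncRatio p fstar (n + 1) f y ∂μ := by
  have hdom : ∀ (n : ℕ) (y : Y), ‖Real.log (truncRatio p fstar (n + 1) f y)‖
      ≤ |Real.log (mixture p fstar y / mixture p f y)| := fun n y => by
    rw [truncRatio, Real.norm_eq_abs]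
    rcases le_total (mixture p fstar y / mixture p f y) (n + 1 : ℝ) with hle | hle
    · rw [min_eq_left hle]
    · have h1 : (1 : ℝ) ≤ n + 1 := by linarith [Nat.cast_nonneg (α := ℝ) n]
      rw [min_eq_right hle, abs_of_nonneg (Real.log_nonneg h1),
        abs_of_nonneg (Real.log_nonneg (h1.trans hle))]
      exact Real.log_le_log (by linarith) hle
  have hmeas : ∀ n : ℕ,
      AEStronglyMeasurable (fun y => Real.log (truncRatio p fstar (n + 1) f y)) μ :=
    fun n => (h.measurable_truncRatio _ f).log.aestronglyMeasurable
  have hlim : Tendsto (fun n : ℕ => ∫ y, Real.log (truncRatio p fstar (n + 1) f y) ∂μ) atTop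
      (𝓝 (∫ y, Real.log (mixture p fstar y / mixture p f y) ∂μ)) := by
    refine tendsto_integral_of_dominated_convergence _ hmeas (h.integrable f hf).abs
      (fun n => Eventually.of_forall (hdom n)) (Eventually.of_forall fun y => ?_)
    refine tendsto_const_nhds.congr' ?_
    obtain ⟨N, hN⟩ := exists_nat_ge (mixture p fstar y / mixture p f y)
    filter_upwards [eventually_ge_atTop N] with n hn
    have : (N : ℝ) ≤ n := by exact_mod_cast hn
    rw [truncRatio, min_eq_left (by linarith)]
  obtain ⟨n, hn⟩ := (hlim.eventually_const_lt (h.integral_pos f hf hne)).exists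
  refine ⟨n, ?_⟩
  have hi := h.integrable_truncRatio (L := n + 1) (by positivity) hf
  have h1 : ∫ y, Real.log (truncRatio p fstar (n + 1) f y) ∂μ
      ≤ ∫ y, (truncRatio p fstar (n + 1) f y - 1) ∂μ :=
    integral_mono ((h.integrable f hf).abs.mono' (hmeas n) (Eventually.of_forall (hdom n)))
      (hi.sub (integrable_const _)) fun y =>
        Real.log_le_sub_one_of_pos (lt_min (h.ratio_pos hf y) (by positivity))
  rw [integral_sub hi (integrable_const _)] at h1
  simp only [integral_const, probReal_univ, smul_eq_mul, one_mul] at h1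
  linarith

/-- One truncation level makes the truncated drift nonnegative on the whole simplex, with `fstar`
as its only zero. -/
theorem exists_truncation :
    ∃ L : ℝ, 0 ≤ L ∧ (∀ f ∈ stdSimplex ℝ U, 1 ≤ ∫ y, truncRatio p fstar L f y ∂μ) ∧
      ∀ f ∈ stdSimplex ℝ U, ∫ y, truncRatio p fstar L f y ∂μ = 1 → f = fstar := by
  suffices ∃ L : ℝ, 1 ≤ L ∧ ∀ f ∈ stdSimplex ℝ U, f ≠ fstar →
      1 < ∫ y, truncRatio p fstar L f y ∂μ by
    obtain ⟨L, hL, hlt⟩ := this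
    refine ⟨L, by linarith, fun f hf => ?_, fun f hf he => ?_⟩
    · rcases eq_or_ne f fstar with rfl | hne
      · have : ∀ y, truncRatio p f L f y = 1 := fun y => by
          rw [truncRatio, div_self (mixture_pos h.pos hf y).ne', min_eq_left hL]
        simp [this]
      · exact (hlt f hf hne).le
    · by_contra hne
      exact (hlt f hf hne).ne' he
  -- near `fstar` the ratio is at most two, so truncation above two has no effect there
  have hnear : ∀ f ∈ stdSimplex ℝ U, (∀ u, fstar u ≤ 2 * f u) → f ≠ fstar → ∀ L : ℝ, 2 ≤ L →
      1 < ∫ y, truncRatio p fstar L f y ∂μ := by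
    intro f hf hle hne L hL
    have hT : ∀ y, truncRatio p fstar L f y = mixture p fstar y / mixture p f y := fun y => by
      rw [truncRatio, min_eq_left]
      rw [div_le_iff₀ (mixture_pos h.pos hf y)]
      calc mixture p fstar y ≤ 2 * mixture p f y := by
            rw [mixture, mixture, Finset.mul_sum]
            refine Finset.sum_le_sum fun u _ => ?_
            have := mul_le_mul_of_nonneg_left (hle u) (h.pos y u).le
            linarith
        _ ≤ L * mixture p f y := by gcongr; exact (mixture_pos h.pos hf y).le
    have hi := h.integrable_truncRatio (L := L) (by linarith) hf
    have h1 : ∫ y, Real.log (mixture p fstar y / mixture p f y) ∂μ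
        ≤ ∫ y, (truncRatio p fstar L f y - 1) ∂μ :=
      integral_mono (h.integrable f hf) (hi.sub (integrable_const _)) fun y => by
        simp only [hT]
        exact Real.log_le_sub_one_of_pos (h.ratio_pos hf y)
    rw [integral_sub hi (integrable_const _)] at h1
    simp only [integral_const, probReal_univ, smul_eq_mul, one_mul] at h1
    linarith [h.integral_pos f hf hne]
  set K : Set (U → ℝ) := stdSimplex ℝ U \ {f | ∀ u, fstar u < 2 * f u} with hK
  have hKsub : K ⊆ stdSimplex ℝ U := Set.sdiff_subset
  have hKc : IsCompact K := by
    refine (isCompact_stdSimplex ℝ U).diff ?_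
    rw [Set.ofPred_forall]
    exact isOpen_iInter_of_finite fun u =>
      isOpen_lt continuous_const (continuous_const.mul (continuous_apply u))
  -- away from `fstar`, finitely many truncation levels suffice by compactness
  have hfar : ∃ n : ℕ, ∀ f ∈ K, 1 < ∫ y, truncRatio p fstar (n + 1) f y ∂μ := by
    by_contra! hcon
    let C : ℕ → Set (U → ℝ) := fun n => K ∩
      (fun f => ∫ y, truncRatio p fstar (n + 1) f y ∂μ) ⁻¹' Set.Iic 1
    have hCclosed : ∀ n, IsClosed (C n) := fun n =>
      ((h.continuousOn_integral_truncRatio (by positivity)).mono hKsub).preimage_isClosed_of_isClosed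
        hKc.isClosed isClosed_Iic
    obtain ⟨f, hf⟩ := IsCompact.nonempty_iInter_of_sequence_nonempty_isCompact_isClosed C
      (fun n f hf => ⟨hf.1, (h.integral_truncRatio_mono (by positivity)
        (by push_cast; linarith) (hKsub hf.1)).trans hf.2⟩)
      (fun n => let ⟨f, hf, hle⟩ := hcon n; ⟨f, hf, hle⟩)
      (hKc.of_isClosed_subset (hCclosed 0) Set.inter_subset_left) hCclosed
    have hf' := Set.mem_iInter.1 hf
    have hne : f ≠ fstar := by
      rintro rfl
      exact (hf' 0).1.2 fun u => by linarith [h.weight_pos u]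
    obtain ⟨n, hn⟩ := h.exists_one_lt_integral_truncRatio (hKsub (hf' 0).1) hne
    exact absurd (hf' n).2 (not_le.2 hn)
  obtain ⟨n, hn⟩ := hfar
  refine ⟨max 2 (n + 1), by linarith [le_max_left (2 : ℝ) (n + 1)], fun f hf hne => ?_⟩
  by_cases hfK : f ∈ K
  · exact (hn f hfK).trans_le
      (h.integral_truncRatio_mono (by positivity) (le_max_right _ _) hf)
  · have : ∀ u, fstar u < 2 * f u := by
      by_contra hc
      exact hfK ⟨hf, hc⟩
    exact hnear f hf (fun u => (this u).le) hne _ (le_max_left _ _)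

end IsInteriorMaximizer

end Excess

/-! ### Convergence of the recursion along a data sequence -/

section Convergence

lemma exists_tendsto_of_le_add {V b s : ℕ → ℝ} (hV : ∀ n, 0 ≤ V n) (hb : ∀ n, 0 ≤ b n)
    (hs : ∃ l, Tendsto (fun n => ∑ k ∈ Finset.range n, s k) atTop (𝓝 l))
    (hstep : ∀ n, V (n + 1) ≤ V n - b n + s n) :
    (∃ l, Tendsto V atTop (𝓝 l)) ∧ Summable b := by
  obtain ⟨l, hl⟩ := hs
  set S : ℕ → ℝ := fun n => ∑ k ∈ Finset.range n, s k with hS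
  have hSb := hl.bddAbove_range
  obtain ⟨M, hM⟩ := hSb
  have hM' : ∀ n, S n ≤ M := fun n => hM ⟨n, rfl⟩
  have hSs : ∀ n, S (n + 1) = S n + s n := fun n => Finset.sum_range_succ _ _
  constructor
  · have hanti : Antitone fun n => V n - S n := antitone_nat_of_succ_le fun n => by
      have h1 := hstep n
      have h2 := hb n
      rw [hSs]; linarith
    have hbdd : BddBelow (Set.range fun n => V n - S n) :=
      ⟨-M, by rintro _ ⟨n, rfl⟩; have := hV n; have := hM' n; simp only; linarith⟩
    refine ⟨_, ((tendsto_atTop_ciInf hanti hbdd).add hl).congr fun n => ?_⟩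
    simp
  · refine summable_of_sum_range_le (c := V 0 + M) hb fun n => ?_
    have key : ∀ n, V n + ∑ k ∈ Finset.range n, b k ≤ V 0 + S n := by
      intro n
      induction n with
      | zero => simp [hS]
      | succ n ih =>
        rw [Finset.sum_range_succ, hSs]
        linarith [hstep n]
    linarith [key n, hV n, hM' n]

lemma frequently_lt_of_summable_mul {a b : ℕ → ℝ} (ha : ∀ n, 0 ≤ a n) (hna : ¬ Summable a)
    (hab : Summable fun n => a n * b n) {η : ℝ} (hη : 0 < η) : ∃ᶠ n in atTop, b n < η := by
  by_contra hcon
  rw [not_frequently] at hcon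
  obtain ⟨N, hN⟩ := eventually_atTop.1 hcon
  refine hna ((summable_nat_add_iff N).1 ?_)
  refine Summable.of_nonneg_of_le (fun n => ha _) (fun n => ?_)
    (((summable_nat_add_iff N).2 hab).mul_left η⁻¹)
  have h1 := not_lt.1 (hN (n + N) (Nat.le_add_left _ _))
  have h2 := mul_le_mul_of_nonneg_left h1 (ha (n + N))
  rw [inv_mul_eq_div, le_div_iff₀ hη]
  exact h2

variable {Y U : Type*} [Fintype U] {p : Y → U → ℝ} {f₀ fstar : U → ℝ}

lemma prIter_succ_apply (w : ℕ → ℝ) (y : ℕ → Y) (n : ℕ) (u : U) :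
    prIter p f₀ w y (n + 1) u = (1 - w (n + 1)) * prIter p f₀ w y n u
      + w (n + 1) * (relDensity p (prIter p f₀ w y n) u (y (n + 1)) * prIter p f₀ w y n u) := by
  simp only [prIter, relDensity]
  ring

lemma prIter_mem_and_pos (hp : ∀ y u, 0 < p y u) (hf₀ : f₀ ∈ stdSimplex ℝ U)
    (hf₀_pos : ∀ u, 0 < f₀ u) {w : ℕ → ℝ} (hw : ∀ n, 1 ≤ n → w n ∈ Set.Ioo (0 : ℝ) 1)
    (y : ℕ → Y) (n : ℕ) :
    prIter p f₀ w y n ∈ stdSimplex ℝ U ∧ ∀ u, 0 < prIter p f₀ w y n u := by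
  induction n with
  | zero => exact ⟨hf₀, hf₀_pos⟩
  | succ n ih =>
    obtain ⟨hm, hpos⟩ := ih
    have hw1 := hw (n + 1) (Nat.le_add_left _ _)
    have hpos' : ∀ u, 0 < prIter p f₀ w y (n + 1) u := fun u => by
      rw [prIter_succ_apply]
      exact add_pos (mul_pos (sub_pos.2 hw1.2) (hpos u))
        (mul_pos hw1.1 (mul_pos (relDensity_pos hp hm u _) (hpos u)))
    refine ⟨⟨fun u => (hpos' u).le, ?_⟩, hpos'⟩
    simp_rw [prIter_succ_apply]
    rw [Finset.sum_add_distrib, ← Finset.mul_sum, ← Finset.mul_sum, sum_relDensity_mul,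
      div_self (mixture_pos hp hm _).ne', hm.2]
    ring

/-- The Kullback-Leibler divergence of `f` from `fstar`, up to an additive constant. -/
noncomputable def crossEntropy (fstar f : U → ℝ) : ℝ := -∑ u, fstar u * Real.log (f u)

lemma crossEntropy_nonneg (hfs : fstar ∈ stdSimplex ℝ U) {f : U → ℝ} (hf : f ∈ stdSimplex ℝ U) :
    0 ≤ crossEntropy fstar f := by
  rw [crossEntropy, neg_nonneg]
  refine Finset.sum_nonpos fun u _ => mul_nonpos_of_nonneg_of_nonpos (hfs.1 u) ?_
  refine Real.log_nonpos (hf.1 u) ?_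
  rw [← hf.2]
  exact Finset.single_le_sum (fun v _ => hf.1 v) (Finset.mem_univ u)

/-- The excess cross entropy dominates the squared Hellinger distance. -/
lemma sum_sq_sqrt_sub_le (hfs : fstar ∈ stdSimplex ℝ U) (hpos : ∀ u, 0 < fstar u) {f : U → ℝ}
    (hf : f ∈ stdSimplex ℝ U) (hfpos : ∀ u, 0 < f u) :
    ∑ u, (√(f u) - √(fstar u)) ^ 2 ≤ crossEntropy fstar f - crossEntropy fstar fstar := by
  have hterm : ∀ u, (√(f u) - √(fstar u)) ^ 2
      ≤ f u - fstar u + (fstar u * Real.log (fstar u) - fstar u * Real.log (f u)) := fun u => by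
    have ha := Real.sqrt_pos.2 (hpos u)
    have hb := Real.sqrt_pos.2 (hfpos u)
    have ha2 := Real.sq_sqrt (hpos u).le
    have hb2 := Real.sq_sqrt (hfpos u).le
    have h1 := Real.log_le_sub_one_of_pos (div_pos hb ha)
    rw [Real.log_div hb.ne' ha.ne', Real.log_sqrt (hpos u).le, Real.log_sqrt (hfpos u).le] at h1
    have h2 := mul_le_mul_of_nonneg_left h1 (mul_nonneg zero_le_two (hpos u).le)
    have h3 : fstar u * (√(f u) / √(fstar u)) = √(f u) * √(fstar u) := by
      rw [← ha2, Real.sqrt_sq ha.le]; field_simp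
    nlinarith
  calc _ ≤ ∑ u, (f u - fstar u
          + (fstar u * Real.log (fstar u) - fstar u * Real.log (f u))) :=
        Finset.sum_le_sum fun u _ => hterm u
    _ = _ := by
        rw [Finset.sum_add_distrib, Finset.sum_sub_distrib, Finset.sum_sub_distrib, hf.2, hfs.2,
          crossEntropy, crossEntropy]
        ring

lemma tendsto_of_tendsto_crossEntropy (hfs : fstar ∈ stdSimplex ℝ U) (hpos : ∀ u, 0 < fstar u)
    {F : ℕ → U → ℝ} (hF : ∀ n, F n ∈ stdSimplex ℝ U) (hFpos : ∀ n u, 0 < F n u)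
    (hV : Tendsto (fun n => crossEntropy fstar (F n)) atTop (𝓝 (crossEntropy fstar fstar))) :
    Tendsto F atTop (𝓝 fstar) := by
  refine tendsto_pi_nhds.2 fun u => ?_
  have hV' := hV.sub_const (crossEntropy fstar fstar)
  rw [sub_self] at hV'
  have h1 : Tendsto (fun n => (√(F n u) - √(fstar u)) ^ 2) atTop (𝓝 0) :=
    squeeze_zero (fun n => sq_nonneg _) (fun n =>
      (Finset.single_le_sum (f := fun u => (√(F n u) - √(fstar u)) ^ 2)
        (fun v _ => sq_nonneg _) (Finset.mem_univ u)).trans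
        (sum_sq_sqrt_sub_le hfs hpos (hF n) (hFpos n))) hV'
  have h2 : Tendsto (fun n => √(F n u) - √(fstar u)) atTop (𝓝 0) := by
    rw [tendsto_zero_iff_abs_tendsto_zero]
    have := h1.sqrt
    rw [Real.sqrt_zero] at this
    exact this.congr fun n => Real.sqrt_sq_eq_abs _
  have h3 := (h2.add_const (√(fstar u))).pow 2
  rw [zero_add, Real.sq_sqrt (hpos u).le] at h3
  exact h3.congr fun n => by rw [sub_add_cancel, Real.sq_sqrt (hFpos n u).le]

/-- One step of the recursion changes the cross entropy by at most the truncated drift and a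
quadratic error. The logarithm being increasing, large values of the relative densities only help,
so they may be cut off. -/
lemma exists_crossEntropy_step (hp : ∀ y u, 0 < p y u) (hfs : fstar ∈ stdSimplex ℝ U)
    (hpos : ∀ u, 0 < fstar u) {L : ℝ} (hL : 0 ≤ L) :
    ∃ C : ℝ, ∀ f ∈ stdSimplex ℝ U, (∀ u, 0 < f u) → ∀ (y : Y) (w : ℝ), 0 < w → w ≤ 1 / 2 →
      crossEntropy fstar (fun u => (1 - w) * f u + w * (relDensity p f u y * f u))
        ≤ crossEntropy fstar f - w * (truncRatio p fstar L f y - 1) + C * w ^ 2 := by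
  set M : ℝ := 1 + ∑ u, L / fstar u with hM
  have hterm0 : ∀ u, 0 ≤ L / fstar u := fun u => div_nonneg hL (hpos u).le
  have hM1 : 1 ≤ M := le_add_of_nonneg_right (Finset.sum_nonneg fun u _ => hterm0 u)
  have hLM : ∀ u, L ≤ fstar u * M := fun u => by
    have h1 := Finset.single_le_sum (fun v _ => hterm0 v) (Finset.mem_univ u)
    have h2 : L / fstar u ≤ M := by rw [hM]; linarith
    rw [mul_comm]
    exact (div_le_iff₀ (hpos u)).1 h2
  refine ⟨2 * M ^ 2, fun f hf hfpos y w hw0 hw1 => ?_⟩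
  set x : U → ℝ := fun u => relDensity p f u y with hx
  have hx0 : ∀ u, 0 < x u := fun u => relDensity_pos hp hf u y
  have hlog : ∀ u, w * (min (x u) M - 1) - 2 * M ^ 2 * w ^ 2
      ≤ Real.log ((1 - w) * f u + w * (x u * f u)) - Real.log (f u) := fun u => by
    have h0 : 0 < min (x u) M := lt_min (hx0 u) (by linarith)
    have h1 : -(1 / 2) ≤ w * (min (x u) M - 1) := by nlinarith
    have h2 := sub_two_mul_sq_le_log h1
    have h3 : (min (x u) M - 1) ^ 2 ≤ M ^ 2 :=
      sq_le_sq' (by linarith) (by linarith [min_le_right (x u) M])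
    have h4 := mul_le_mul_of_nonneg_left h3 (sq_nonneg w)
    have h5 : (1 - w) * f u + w * (x u * f u) = f u * (1 + w * (x u - 1)) := by ring
    have h6 : 0 < 1 + w * (min (x u) M - 1) := by linarith
    have h7 : 1 + w * (min (x u) M - 1) ≤ 1 + w * (x u - 1) := by
      gcongr; exact min_le_left _ _
    rw [h5, Real.log_mul (hfpos u).ne' (h6.trans_le h7).ne']
    have h8 := Real.log_le_log h6 h7
    nlinarith
  have hmin : truncRatio p fstar L f y ≤ ∑ u, fstar u * min (x u) M := by
    rw [truncRatio]
    by_cases hall : ∀ u, x u ≤ M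
    · refine (min_le_left _ _).trans (le_of_eq ?_)
      rw [← sum_relDensity_mul f fstar]
      exact Finset.sum_congr rfl fun u _ => by rw [min_eq_left (hall u), mul_comm]
    · push Not at hall
      obtain ⟨u, hu⟩ := hall
      refine (min_le_right _ _).trans ((hLM u).trans ?_)
      have := Finset.single_le_sum (f := fun u => fstar u * min (x u) M)
        (fun v _ => mul_nonneg (hpos v).le (le_min (hx0 v).le (by linarith))) (Finset.mem_univ u)
      simpa [min_eq_right hu.le] using this
  have hsum := Finset.sum_le_sum fun u (_ : u ∈ Finset.univ) =>
    mul_le_mul_of_nonneg_left (hlog u) (hpos u).le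
  have e1 : ∑ u, fstar u * (w * (min (x u) M - 1) - 2 * M ^ 2 * w ^ 2)
      = w * ∑ u, fstar u * min (x u) M - (w + 2 * M ^ 2 * w ^ 2) * ∑ u, fstar u := by
    rw [Finset.mul_sum, Finset.mul_sum, ← Finset.sum_sub_distrib]
    exact Finset.sum_congr rfl fun u _ => by ring
  rw [e1, hfs.2] at hsum
  simp_rw [mul_sub] at hsum
  rw [Finset.sum_sub_distrib] at hsum
  have h9 := mul_le_mul_of_nonneg_left hmin hw0.le
  simp only [crossEntropy]
  linarith

variable [MeasurableSpace Y] {μ : Measure Y} [IsProbabilityMeasure μ]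

/-- Along a data sequence for which the noise in the truncated drift is summable, the recursion
converges to the maximizer. -/
theorem IsInteriorMaximizer.tendsto_prIter (h : IsInteriorMaximizer μ p fstar)
    (hf₀ : f₀ ∈ stdSimplex ℝ U) (hf₀_pos : ∀ u, 0 < f₀ u) {w : ℕ → ℝ}
    (hw : ∀ n, 1 ≤ n → w n ∈ Set.Ioo (0 : ℝ) 1) (hw1 : ¬ Summable w)
    (hw2 : Summable fun n => w n ^ 2) {y : ℕ → Y} {L : ℝ} (hL : 0 ≤ L)
    (hge : ∀ f ∈ stdSimplex ℝ U, 1 ≤ ∫ y, truncRatio p fstar L f y ∂μ)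
    (heq : ∀ f ∈ stdSimplex ℝ U, ∫ y, truncRatio p fstar L f y ∂μ = 1 → f = fstar)
    (hnoise : ∃ l, Tendsto (fun n => ∑ k ∈ Finset.range n, w (k + 1) *
      (truncRatio p fstar L (prIter p f₀ w y k) (y (k + 1))
        - ∫ z, truncRatio p fstar L (prIter p f₀ w y k) z ∂μ)) atTop (𝓝 l)) :
    Tendsto (prIter p f₀ w y) atTop (𝓝 fstar) := by
  set F := prIter p f₀ w y
  have hFmem : ∀ n, F n ∈ stdSimplex ℝ U := fun n =>
    (prIter_mem_and_pos h.pos hf₀ hf₀_pos hw y n).1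
  have hFpos : ∀ n u, 0 < F n u := fun n => (prIter_mem_and_pos h.pos hf₀ hf₀_pos hw y n).2
  have hFsucc : ∀ n, F (n + 1) = fun u => (1 - w (n + 1)) * F n u
      + w (n + 1) * (relDensity p (F n) u (y (n + 1)) * F n u) :=
    fun n => funext fun u => prIter_succ_apply w y n u
  clear_value F
  have hcont := h.continuousOn_integral_truncRatio hL
  obtain ⟨D, hD⟩ : ∃ D : (U → ℝ) → ℝ, ∀ f, D f = ∫ z, truncRatio p fstar L f z ∂μ :=
    ⟨_, fun _ => rfl⟩
  simp only [← hD] at hcont hge heq hnoise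
  obtain ⟨C, hC⟩ := exists_crossEntropy_step h.pos h.mem h.weight_pos hL
  have hw0 : Tendsto (fun n => w (n + 1)) atTop (𝓝 0) := by
    have h1 := (hw2.tendsto_atTop_zero.comp (tendsto_add_atTop_nat 1)).sqrt
    rw [Real.sqrt_zero] at h1
    exact h1.congr fun n => Real.sqrt_sq (hw (n + 1) (Nat.le_add_left _ _)).1.le
  obtain ⟨N, hN⟩ := eventually_atTop.1
    (hw0.eventually_le_const (show (0 : ℝ) < 1 / 2 by norm_num))
  set s : ℕ → ℝ := fun k => -(w (k + 1) * (truncRatio p fstar L (F k) (y (k + 1)) - D (F k)))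
    + C * w (k + 1) ^ 2 with hs
  have hsum : ∃ l, Tendsto (fun n => ∑ k ∈ Finset.range n, s k) atTop (𝓝 l) := by
    obtain ⟨l, hl⟩ := hnoise
    have h2 := (((summable_nat_add_iff 1).2 hw2).mul_left C).hasSum.tendsto_sum_nat
    refine ⟨_, (hl.neg.add h2).congr fun n => ?_⟩
    rw [hs, Finset.sum_add_distrib, Finset.sum_neg_distrib]
  have hsumN : ∃ l, Tendsto (fun n => ∑ k ∈ Finset.range n, s (k + N)) atTop (𝓝 l) := by
    obtain ⟨l, hl⟩ := hsum
    refine ⟨_, ((hl.comp (tendsto_add_atTop_nat N)).sub_const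
      (∑ k ∈ Finset.range N, s k)).congr fun n => ?_⟩
    simp only [Function.comp_apply]
    rw [add_comm n N, Finset.sum_range_add, add_sub_cancel_left]
    exact Finset.sum_congr rfl fun k _ => by rw [add_comm]
  obtain ⟨⟨l, hl⟩, hb⟩ := exists_tendsto_of_le_add
    (V := fun n => crossEntropy fstar (F (n + N)))
    (b := fun n => w (n + N + 1) * (D (F (n + N)) - 1)) (s := fun k => s (k + N))
    (fun n => crossEntropy_nonneg h.mem (hFmem _))
    (fun n => mul_nonneg (hw _ (Nat.le_add_left _ _)).1.le (sub_nonneg.2 (hge _ (hFmem _))))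
    hsumN (fun n => by
      have h1 := hC (F (n + N)) (hFmem _) (hFpos _) (y (n + N + 1)) (w (n + N + 1))
        (hw _ (Nat.le_add_left _ _)).1 (hN _ (Nat.le_add_left _ _))
      have h2 : F (n + 1 + N) = fun u => (1 - w (n + N + 1)) * F (n + N) u
          + w (n + N + 1) * (relDensity p (F (n + N)) u (y (n + N + 1)) * F (n + N) u) := by
        rw [show n + 1 + N = n + N + 1 by ring, hFsucc]
      rw [h2, hs]
      linarith)
  have hV : Tendsto (fun n => crossEntropy fstar (F n)) atTop (𝓝 l) :=
    (tendsto_add_atTop_iff_nat N).1 hl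
  -- the drift is small infinitely often, so `fstar` is a limit point
  have hb' : Summable fun n => w (n + 1) * (D (F n) - 1) :=
    (summable_nat_add_iff (f := fun n => w (n + 1) * (D (F n) - 1)) N).1 hb
  have hfreq : ∀ k : ℕ, ∃ᶠ n in atTop, D (F n) - 1 < 1 / ((k : ℝ) + 1) := fun k =>
    frequently_lt_of_summable_mul (a := fun n => w (n + 1))
      (fun n => (hw _ (Nat.le_add_left _ _)).1.le)
      (fun hc => hw1 ((summable_nat_add_iff 1).1 hc)) hb' (by positivity)
  obtain ⟨φ, hφ, hφD⟩ := extraction_forall_of_frequently hfreq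
  obtain ⟨g, hg, ψ, hψ, hlim⟩ := (isCompact_stdSimplex ℝ U).tendsto_subseq
    (x := fun k => F (φ k)) fun k => hFmem _
  have hDlim : Tendsto (fun k => D (F (φ (ψ k)))) atTop (𝓝 (D g)) := by
    exact (hcont g hg).tendsto.comp (tendsto_nhdsWithin_iff.2
      ⟨hlim, Eventually.of_forall fun k => hFmem _⟩)
  have hDg : D g = 1 := by
    refine le_antisymm ?_ (hge g hg)
    have h1 : Tendsto (fun k : ℕ => 1 / ((ψ k : ℝ) + 1) + 1) atTop (𝓝 (0 + 1)) :=
      ((tendsto_one_div_add_atTop_nhds_zero_nat (𝕜 := ℝ)).comp hψ.tendsto_atTop).add_const 1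
    rw [zero_add] at h1
    exact le_of_tendsto_of_tendsto' hDlim h1 fun k => by linarith [hφD (ψ k)]
  have hgs := heq g hg hDg
  subst hgs
  have hVlim : Tendsto (fun k => crossEntropy g (F (φ (ψ k)))) atTop (𝓝 (crossEntropy g g)) := by
    refine (tendsto_finsetSum _ fun u _ => ?_).neg
    exact (((tendsto_pi_nhds.1 hlim u).log (h.weight_pos u).ne')).const_mul _
  have hlV := tendsto_nhds_unique (hV.comp (hφ.comp hψ).tendsto_atTop) hVlim
  rw [hlV] at hV
  exact tendsto_of_tendsto_crossEntropy h.mem h.weight_pos hFmem hFpos hV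

end Convergence

/-! ### The rate of a linearly stable stochastic approximation -/

section Rate

/-- A contraction with non-summable rates `c * w n` and perturbations `o(w n)` tends to zero. -/
lemma tendsto_zero_of_le_one_sub_mul {a w e : ℕ → ℝ} {c : ℝ} (hc : 0 < c) (ha : ∀ n, 0 ≤ a n)
    (hw : ∀ n, 0 < w n) (hw0 : Tendsto w atTop (𝓝 0)) (hws : ¬ Summable w)
    (he : Tendsto e atTop (𝓝 0))
    (hstep : ∀ᶠ n in atTop, a (n + 1) ≤ (1 - c * w n) * a n + w n * e n) :
    Tendsto a atTop (𝓝 0) := by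
  refine tendsto_order.2 ⟨fun b hb => Eventually.of_forall fun n => hb.trans_le (ha n),
    fun η' hη' => ?_⟩
  obtain ⟨η, hη0, hη⟩ := exists_between hη'
  have hcw : Tendsto (fun n => c * w n) atTop (𝓝 0) := by
    simpa using hw0.const_mul c
  obtain ⟨N, hN⟩ := eventually_atTop.1 (hstep.and
    ((he.eventually_le_const (show (0 : ℝ) < c * η by positivity)).and
      (hcw.eventually_le_const one_pos)))
  -- the part of `a` above the level `η` contracts without perturbation
  set b : ℕ → ℝ := fun n => max (a (n + N) - η) 0 with hb
  have hb0 : ∀ n, 0 ≤ b n := fun n => le_max_right _ _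
  have hbstep : ∀ n, b (n + 1) ≤ b n - c * (w (n + N) * b n) + 0 := fun n => by
    obtain ⟨h1, h2, h3⟩ := hN (n + N) (Nat.le_add_left _ _)
    have h4 : a (n + N) - η ≤ b n := le_max_left _ _
    have h5 := mul_le_mul_of_nonneg_left h4 (sub_nonneg.2 h3)
    have h6 := mul_le_mul_of_nonneg_left h2 (hw (n + N)).le
    have h7 := mul_nonneg (sub_nonneg.2 h3) (hb0 n)
    refine max_le ?_ (by linarith)
    rw [show n + 1 + N = n + N + 1 by ring]
    linarith
  obtain ⟨⟨l, hl⟩, hsum⟩ := exists_tendsto_of_le_add hb0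
    (fun n => mul_nonneg hc.le (mul_nonneg (hw (n + N)).le (hb0 n))) (s := fun _ => 0)
    ⟨0, by simp⟩ hbstep
  have hsum' := (summable_mul_left_iff hc.ne').1 hsum
  have hfreq : ∃ᶠ n in atTop, b n < η' - η :=
    frequently_lt_of_summable_mul (fun n => (hw (n + N)).le)
      (fun hs => hws ((summable_nat_add_iff N).1 hs)) hsum' (sub_pos.2 hη)
  have hanti : Antitone b := antitone_nat_of_succ_le fun n => by
    have h1 := hbstep n
    have h2 := mul_nonneg hc.le (mul_nonneg (hw (n + N)).le (hb0 n))
    linarith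
  obtain ⟨n₀, hn₀⟩ := hfreq.exists
  filter_upwards [eventually_ge_atTop (n₀ + N)] with n hn
  obtain ⟨k, rfl⟩ : ∃ k, n = k + N := ⟨n - N, by omega⟩
  have h1 := hanti (show n₀ ≤ k by omega)
  have h2 : a (k + N) - η ≤ b k := le_max_left _ _
  linarith

lemma abs_rpow_sub_one_le {x δ : ℝ} (hx : 0 < x) (h0 : 0 ≤ δ) (h1 : δ ≤ 1) :
    |x ^ δ - 1| ≤ |x - 1| := by
  rcases le_total 1 x with h | h
  · have e1 := Real.one_le_rpow h h0
    have e2 := Real.rpow_le_rpow_of_exponent_le h h1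
    rw [Real.rpow_one] at e2
    rw [abs_of_nonneg (by linarith), abs_of_nonneg (by linarith)]
    linarith
  · have e1 := Real.rpow_le_one hx.le h h0
    have e2 := Real.rpow_le_rpow_of_exponent_ge hx h h1
    rw [Real.rpow_one] at e2
    rw [abs_of_nonpos (by linarith), abs_of_nonpos (by linarith)]
    linarith

variable {E : Type*} [NormedAddCommGroup E] [InnerProductSpace ℝ E]

lemma norm_sub_smul_le {B : E →L[ℝ] E} {c : ℝ}
    (hB : ∀ x, c * ‖x‖ ^ 2 ≤ inner ℝ x (B x)) {w : ℝ} (hw : 0 ≤ w)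
    (hwB : w * ‖B‖ ^ 2 ≤ c) (hwc : c / 2 * w ≤ 1) (x : E) :
    ‖x - w • B x‖ ≤ (1 - c / 2 * w) * ‖x‖ := by
  refine abs_le_of_sq_le_sq' ?_ (mul_nonneg (by linarith) (norm_nonneg _)) |>.2
  rw [norm_sub_sq_real, real_inner_smul_right, norm_smul, Real.norm_of_nonneg hw]
  have h1 := mul_le_mul_of_nonneg_left (hB x) hw
  have h2 : ‖B x‖ ^ 2 ≤ ‖B‖ ^ 2 * ‖x‖ ^ 2 := by
    rw [← mul_pow]
    exact pow_le_pow_left₀ (norm_nonneg _) (B.le_opNorm x) 2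
  have h3 : w ^ 2 * ‖B x‖ ^ 2 ≤ w * c * ‖x‖ ^ 2 := by
    calc w ^ 2 * ‖B x‖ ^ 2 ≤ w ^ 2 * (‖B‖ ^ 2 * ‖x‖ ^ 2) := by gcongr
      _ = w * (w * ‖B‖ ^ 2) * ‖x‖ ^ 2 := by ring
      _ ≤ w * c * ‖x‖ ^ 2 := by gcongr
  nlinarith [sq_nonneg (c / 2 * w * ‖x‖)]

/-- Let `x (n + 1) = x n + w n • (-B (x n) + R n + M n)` tend to zero, with `B` coercive and `R`
quadratically small. If the noise is summable with the weights `w n ^ (1 - δ)` then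
`x n = o(w n ^ δ)`. The rescaled iterates, corrected by the tail of the rescaled noise, satisfy a
noiseless perturbed contraction; the condition on `(w n)⁻¹` makes the change of scale from one step
to the next negligible against the contraction. -/
theorem tendsto_smul_zero_of_linear_recursion {B : E →L[ℝ] E} {c : ℝ} (hc : 0 < c)
    (hB : ∀ x, c * ‖x‖ ^ 2 ≤ inner ℝ x (B x)) {x R M : ℕ → E} {w : ℕ → ℝ} {δ C : ℝ}
    (hw : ∀ n, 0 < w n) (hw0 : Tendsto w atTop (𝓝 0)) (hws : ¬ Summable w)
    (hwd : Tendsto (fun n => (w (n + 1))⁻¹ - (w n)⁻¹) atTop (𝓝 0))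
    (hδ0 : 0 ≤ δ) (hδ1 : δ ≤ 1) (hx : Tendsto x atTop (𝓝 0))
    (hrec : ∀ n, x (n + 1) = x n + w (n + 1) • (-B (x n) + R n + M n))
    (hC : 0 ≤ C) (hR : ∀ᶠ n in atTop, ‖R n‖ ≤ C * ‖x n‖ ^ 2)
    (hM : ∃ l, Tendsto (fun n => ∑ k ∈ Finset.range n, w (k + 1) ^ (1 - δ) • M k) atTop (𝓝 l)) :
    Tendsto (fun n => w n ^ (-δ) • x n) atTop (𝓝 0) := by
  obtain ⟨l, hl⟩ := hM
  set r : ℕ → E := fun n => l - ∑ k ∈ Finset.range n, w (k + 1) ^ (1 - δ) • M k with hr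
  have hr0 : Tendsto r atTop (𝓝 0) := by simpa [hr] using hl.const_sub l
  have hrs : ∀ n, w (n + 1) ^ (1 - δ) • M n = r n - r (n + 1) := fun n => by
    simp only [hr, Finset.sum_range_succ]; abel
  clear_value r
  set z : ℕ → E := fun n => w n ^ (-δ) • x n with hz
  suffices hlim : Tendsto (fun n => ‖z n + r n‖) atTop (𝓝 0) by
    have := (tendsto_zero_iff_norm_tendsto_zero.2 hlim).sub hr0
    simpa using this
  set ρ : ℕ → ℝ := fun n => (w n / w (n + 1)) ^ δ with hρ
  have hρ0 : ∀ n, 0 < ρ n := fun n => Real.rpow_pos_of_pos (div_pos (hw _) (hw _)) _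
  have hscale : ∀ n, w (n + 1) ^ (-δ) = ρ n * w n ^ (-δ) := fun n => by
    simp only [hρ]
    rw [Real.div_rpow (hw _).le (hw _).le, Real.rpow_neg (hw _).le, Real.rpow_neg (hw _).le]
    have := (Real.rpow_pos_of_pos (hw n) δ).ne'
    field_simp
  have hscale' : ∀ n, w (n + 1) ^ (-δ) * w (n + 1) = w (n + 1) ^ (1 - δ) := fun n => by
    nth_rw 2 [← Real.rpow_one (w (n + 1))]
    rw [← Real.rpow_add (hw _)]
    congr 1
    ring
  have hzrec : ∀ n, z (n + 1) + r (n + 1)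
      = ρ n • ((z n + r n) - w (n + 1) • B (z n + r n)) + (1 - ρ n) • r n
        + (ρ n * w (n + 1)) • (B (r n) + w n ^ (-δ) • R n) := fun n => by
    have h1 : z (n + 1) = ρ n • (z n + w (n + 1) • (-B (z n) + w n ^ (-δ) • R n))
        + w (n + 1) ^ (1 - δ) • M n := by
      simp only [hz, hrec n]
      rw [← hscale', hscale, map_smul]
      module
    rw [h1, hrs, map_add]
    module
  -- the relative change of scale is `o(w (n + 1))`
  have hquot : ∀ n, w n / w (n + 1) - 1 = w n * ((w (n + 1))⁻¹ - (w n)⁻¹) := fun n => by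
    have := (hw n).ne'
    field_simp
  have hq1 : Tendsto (fun n => w n / w (n + 1) - 1) atTop (𝓝 0) := by
    simp_rw [hquot]
    simpa using hw0.mul hwd
  set d : ℕ → ℝ := fun n => 2 * |(w (n + 1))⁻¹ - (w n)⁻¹| with hd
  have hd0 : Tendsto d atTop (𝓝 0) := by simpa [hd] using (hwd.abs).const_mul 2
  have hρ1 : ∀ᶠ n in atTop, |ρ n - 1| ≤ d n * w (n + 1) := by
    filter_upwards [hq1.eventually_le_const one_pos] with n hn
    have h1 : w n ≤ 2 * w (n + 1) := by
      rw [← div_le_iff₀ (hw _)]; linarith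
    calc |ρ n - 1| ≤ |w n / w (n + 1) - 1| :=
          abs_rpow_sub_one_le (div_pos (hw _) (hw _)) hδ0 hδ1
      _ = w n * |(w (n + 1))⁻¹ - (w n)⁻¹| := by rw [hquot, abs_mul, abs_of_pos (hw n)]
      _ ≤ 2 * w (n + 1) * |(w (n + 1))⁻¹ - (w n)⁻¹| := by gcongr
      _ = d n * w (n + 1) := by simp only [hd]; ring
  have hw0' : Tendsto (fun n => w (n + 1)) atTop (𝓝 0) := hw0.comp (tendsto_add_atTop_nat 1)
  have hxn : Tendsto (fun n => ‖x n‖) atTop (𝓝 0) := tendsto_zero_iff_norm_tendsto_zero.1 hx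
  have hrn : Tendsto (fun n => ‖r n‖) atTop (𝓝 0) := tendsto_zero_iff_norm_tendsto_zero.1 hr0
  refine tendsto_zero_of_le_one_sub_mul (w := fun n => w (n + 1)) (c := c / 4)
    (e := fun n => (d n + 2 * ‖B‖ + 2 * C * ‖x n‖) * ‖r n‖) (by positivity)
    (fun n => norm_nonneg _) (fun n => hw _) hw0'
    (fun hs => hws ((summable_nat_add_iff 1).1 hs)) ?_ ?_
  · have := ((hd0.add_const (2 * ‖B‖)).add (hxn.const_mul (2 * C))).mul hrn
    simpa using this
  have hsmall1 : ∀ᶠ n in atTop, w (n + 1) * ‖B‖ ^ 2 ≤ c := by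
    have : Tendsto (fun n => w (n + 1) * ‖B‖ ^ 2) atTop (𝓝 0) := by
      simpa using hw0'.mul_const (‖B‖ ^ 2)
    exact this.eventually_le_const hc
  have hsmall2 : ∀ᶠ n in atTop, c / 2 * w (n + 1) ≤ 1 := by
    have : Tendsto (fun n => c / 2 * w (n + 1)) atTop (𝓝 0) := by
      simpa using hw0'.const_mul (c / 2)
    exact this.eventually_le_const one_pos
  have hsmall3 : ∀ᶠ n in atTop, d n + 2 * C * ‖x n‖ ≤ c / 4 := by
    have : Tendsto (fun n => d n + 2 * C * ‖x n‖) atTop (𝓝 0) := by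
      simpa using hd0.add (hxn.const_mul (2 * C))
    exact this.eventually_le_const (by positivity)
  have hsmall4 : ∀ᶠ n in atTop, d n * w (n + 1) ≤ 1 := by
    have : Tendsto (fun n => d n * w (n + 1)) atTop (𝓝 0) := by
      simpa using hd0.mul hw0'
    exact this.eventually_le_const one_pos
  filter_upwards [hR, hρ1, hsmall1, hsmall2, hsmall3, hsmall4] with n hRn hρn h1 h2 h3 h4
  have hwn := hw (n + 1)
  have hρle : ρ n ≤ 1 + d n * w (n + 1) := by linarith [(abs_le.1 hρn).2]
  have hρ2 : ρ n ≤ 2 := by linarith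
  have hzx : w n ^ (-δ) * ‖x n‖ = ‖z n‖ := by
    simp only [hz]
    rw [norm_smul, Real.norm_of_nonneg (Real.rpow_nonneg (hw n).le _)]
  have hzr : ‖z n‖ ≤ ‖z n + r n‖ + ‖r n‖ := by
    simpa using norm_sub_le (z n + r n) (r n)
  have hRz : ‖w n ^ (-δ) • R n‖ ≤ C * ‖x n‖ * (‖z n + r n‖ + ‖r n‖) := by
    rw [norm_smul, Real.norm_of_nonneg (Real.rpow_nonneg (hw n).le _)]
    calc w n ^ (-δ) * ‖R n‖ ≤ w n ^ (-δ) * (C * ‖x n‖ ^ 2) :=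
          mul_le_mul_of_nonneg_left hRn (Real.rpow_nonneg (hw n).le _)
      _ = C * ‖x n‖ * (w n ^ (-δ) * ‖x n‖) := by ring
      _ ≤ _ := by
          rw [hzx]
          exact mul_le_mul_of_nonneg_left hzr (mul_nonneg hC (norm_nonneg _))
  have t1 : ‖ρ n • ((z n + r n) - w (n + 1) • B (z n + r n))‖
      ≤ (1 + d n * w (n + 1)) * ((1 - c / 2 * w (n + 1)) * ‖z n + r n‖) := by
    rw [norm_smul, Real.norm_of_nonneg (hρ0 n).le]
    exact mul_le_mul hρle (norm_sub_smul_le hB hwn.le h1 h2 _) (norm_nonneg _)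
      ((hρ0 n).le.trans hρle)
  have t2 : ‖(1 - ρ n) • r n‖ ≤ d n * w (n + 1) * ‖r n‖ := by
    rw [norm_smul, Real.norm_eq_abs, abs_sub_comm]
    exact mul_le_mul_of_nonneg_right hρn (norm_nonneg _)
  have t3 : ‖(ρ n * w (n + 1)) • (B (r n) + w n ^ (-δ) • R n)‖
      ≤ 2 * w (n + 1) * (‖B‖ * ‖r n‖ + C * ‖x n‖ * (‖z n + r n‖ + ‖r n‖)) := by
    rw [norm_smul, Real.norm_of_nonneg (mul_nonneg (hρ0 n).le hwn.le)]
    refine mul_le_mul (mul_le_mul_of_nonneg_right hρ2 hwn.le) ?_ (norm_nonneg _)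
      (by positivity)
    exact (norm_add_le _ _).trans (add_le_add (B.le_opNorm _) hRz)
  have hdn : 0 ≤ d n := mul_nonneg zero_le_two (abs_nonneg _)
  have t4 : (1 + d n * w (n + 1)) * ((1 - c / 2 * w (n + 1)) * ‖z n + r n‖)
      ≤ (1 - c / 2 * w (n + 1) + d n * w (n + 1)) * ‖z n + r n‖ := by
    have := mul_nonneg (mul_nonneg hdn hwn.le)
      (mul_nonneg (mul_nonneg (by positivity : 0 ≤ c / 2) hwn.le) (norm_nonneg (z n + r n)))
    nlinarith
  have t5 : (d n + 2 * C * ‖x n‖) * (w (n + 1) * ‖z n + r n‖)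
      ≤ c / 4 * (w (n + 1) * ‖z n + r n‖) :=
    mul_le_mul_of_nonneg_right h3 (mul_nonneg hwn.le (norm_nonneg _))
  rw [hzrec]
  refine (norm_add₃_le).trans ?_
  linarith

end Rate

/-! ### Almost sure convergence and rate -/

section AlmostSure

variable {Y U Ω : Type*} [Fintype U]

/-- The recursion sees the kernel only through its values at the data from time `1` on. -/
lemma prIter_congr {p p' : Y → U → ℝ} {f₀ : U → ℝ} {w : ℕ → ℝ} {y y' : ℕ → Y}
    (h : ∀ n, p (y (n + 1)) = p' (y' (n + 1))) (n : ℕ) :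
    prIter p f₀ w y n = prIter p' f₀ w y' n := by
  induction n with
  | zero => rfl
  | succ n ih =>
    ext u
    simp only [prIter, mixture, ih, h]

omit [Fintype U] in
lemma continuous_deviation (fstar : U → ℝ) : Continuous (deviation fstar) := by
  unfold deviation
  fun_prop

omit [Fintype U] in
lemma deviation_self (fstar : U → ℝ) : deviation fstar fstar = 0 := by
  ext u; simp [deviation]

lemma euclDist_le_norm_deviation {fstar : U → ℝ} (hfs : fstar ∈ stdSimplex ℝ U)
    (hpos : ∀ u, 0 < fstar u) (f : U → ℝ) : euclDist f fstar ≤ ‖deviation fstar f‖ := by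
  rw [euclDist, EuclideanSpace.norm_eq, EuclideanSpace.norm_eq]
  refine Real.sqrt_le_sqrt (Finset.sum_le_sum fun u _ => pow_le_pow_left₀ (norm_nonneg _) ?_ 2)
  have h1 : fstar u ≤ 1 := by
    rw [← hfs.2]
    exact Finset.single_le_sum (fun v _ => hfs.1 v) (Finset.mem_univ u)
  have hs := Real.sqrt_pos.2 (hpos u)
  simp only [deviation, Pi.sub_apply, norm_div, Real.norm_of_nonneg hs.le]
  rw [le_div_iff₀ hs]
  exact mul_le_of_le_one_right (norm_nonneg _) (Real.sqrt_le_one.2 h1)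

lemma summable_rpow_of_le {w : ℕ → ℝ} (hw : ∀ n, 1 ≤ n → w n ∈ Set.Ioo (0 : ℝ) 1) {a b : ℝ}
    (hab : a ≤ b) (ha : Summable fun n => w n ^ a) : Summable fun n => w (n + 1) ^ b := by
  refine Summable.of_nonneg_of_le (fun n => ?_) (fun n => ?_) ((summable_nat_add_iff 1).2 ha)
  · exact Real.rpow_nonneg (hw (n + 1) (Nat.le_add_left _ _)).1.le _
  · have h := hw (n + 1) (Nat.le_add_left _ _)
    exact Real.rpow_le_rpow_of_exponent_ge h.1 h.2.le hab

variable [MeasurableSpace Y] {p : Y → U → ℝ}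

lemma measurable_uncurry_mixture (hp : ∀ u, Measurable fun y => p y u) :
    Measurable (Function.uncurry (mixture p)) :=
  Finset.measurable_fun_sum _ fun u _ => ((hp u).comp measurable_snd).mul
    ((measurable_pi_apply u).comp measurable_fst)

lemma measurable_uncurry_relDensity_mul (hp : ∀ u, Measurable fun y => p y u) (u : U) :
    Measurable (Function.uncurry fun f y => relDensity p f u y * f u) :=
  (((hp u).comp measurable_snd).div (measurable_uncurry_mixture hp)).mul
    ((measurable_pi_apply u).comp measurable_fst)

lemma measurable_uncurry_truncRatio (hp : ∀ u, Measurable fun y => p y u) (fstar : U → ℝ) (L : ℝ) :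
    Measurable (Function.uncurry (truncRatio p fstar L)) :=
  (((measurable_mixture hp fstar).comp measurable_snd).div
    (measurable_uncurry_mixture hp)).min measurable_const

lemma measurable_history_prIter (hp : ∀ u, Measurable fun y => p y u) (f₀ : U → ℝ) (w : ℕ → ℝ)
    (Z : ℕ → Ω → Y) (n : ℕ) :
    Measurable[history Z n] fun ω => prIter p f₀ w (fun i => Z (i - 1) ω) n := by
  induction n with
  | zero => exact measurable_const
  | succ n ih =>
    have hF : Measurable[history Z (n + 1)] fun ω => prIter p f₀ w (fun i => Z (i - 1) ω) n :=
      ih.mono (history_mono Z n.le_succ) le_rfl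
    refine @measurable_pi_lambda _ _ _ (history Z (n + 1)) _ _ fun u => ?_
    simp_rw [prIter_succ_apply]
    have h1 := (measurable_uncurry_relDensity_mul hp u).comp
      (hF.prodMk (measurable_history (Z := Z) n.lt_succ_self))
    exact (((measurable_pi_apply u).comp hF).const_mul _).add (h1.const_mul _)

variable [MeasurableSpace Ω] {μ : Measure Y} {fstar f₀ : U → ℝ}
  {P : Measure Ω} [IsProbabilityMeasure P]

/-- The rate along a data sequence on which the two noise series converge. -/
lemma IsInteriorMaximizer.isLittleO_of_noise [IsProbabilityMeasure μ]
    (h : IsInteriorMaximizer μ p fstar)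
    (hf₀ : f₀ ∈ stdSimplex ℝ U) (hf₀_pos : ∀ u, 0 < f₀ u) {w : ℕ → ℝ}
    (hw : ∀ n, 1 ≤ n → w n ∈ Set.Ioo (0 : ℝ) 1) (hws : ¬ Summable w)
    (hw0 : Tendsto w atTop (𝓝 0))
    (hwd : Tendsto (fun n => (w (n + 1))⁻¹ - (w n)⁻¹) atTop (𝓝 0)) {δ : ℝ} (hδ0 : 0 ≤ δ)
    (hδ1 : δ ≤ 1) {y : ℕ → Y} (hlim : Tendsto (prIter p f₀ w y) atTop (𝓝 fstar))
    (hnoise : ∀ u, ∃ l, Tendsto (fun n => ∑ k ∈ Finset.range n, w (k + 1) ^ (1 - δ) *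
      (relDensity p (prIter p f₀ w y k) u (y (k + 1)) * prIter p f₀ w y k u
        - ∫ z, relDensity p (prIter p f₀ w y k) u z * prIter p f₀ w y k u ∂μ)) atTop (𝓝 l)) :
    (fun n => euclDist (prIter p f₀ w y n) fstar) =o[atTop] fun n => w n ^ δ := by
  obtain ⟨c, hc, hB⟩ := h.exists_gram_coercive
  obtain ⟨C, r, hC, hr, hCr⟩ := h.exists_norm_meanField_add_gram_le
  have hmem : ∀ n, prIter p f₀ w y n ∈ stdSimplex ℝ U := fun n =>
    (prIter_mem_and_pos h.pos hf₀ hf₀_pos hw y n).1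
  have hsucc := prIter_succ_apply (p := p) (f₀ := f₀) w y
  set F := prIter p f₀ w y
  clear_value F
  set x : ℕ → EuclideanSpace ℝ U := fun n => deviation fstar (F n) with hx
  set R : ℕ → EuclideanSpace ℝ U := fun n =>
    WithLp.toLp 2 (fun u => meanField μ p (F n) u / √(fstar u)) + gram μ p fstar (x n) with hR
  set M : ℕ → EuclideanSpace ℝ U := fun n => WithLp.toLp 2 fun u =>
    (relDensity p (F n) u (y (n + 1)) * F n u - ∫ z, relDensity p (F n) u z * F n u ∂μ)
      / √(fstar u) with hM
  have hx0 : Tendsto x atTop (𝓝 0) := by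
    rw [← deviation_self fstar]
    exact ((continuous_deviation fstar).tendsto fstar).comp hlim
  have hrec : ∀ n, x (n + 1) = x n + w (n + 1) • (-gram μ p fstar (x n) + R n + M n) := fun n => by
    have e1 : -gram μ p fstar (x n) + R n + M n
        = WithLp.toLp 2 (fun u => meanField μ p (F n) u / √(fstar u)) + M n := by
      simp only [hR]; abel
    rw [e1]
    ext u
    have hs := (Real.sqrt_pos.2 (h.weight_pos u)).ne'
    simp only [hx, hM, deviation, meanField, hsucc, PiLp.add_apply, PiLp.smul_apply, smul_eq_mul]
    field_simp
    ring
  have hRx : ∀ᶠ n in atTop, ‖R n‖ ≤ C * ‖x n‖ ^ 2 := by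
    filter_upwards [(tendsto_zero_iff_norm_tendsto_zero.1 hx0).eventually_le_const hr] with n hn
    exact hCr _ (hmem n) hn
  have hMs : ∃ l, Tendsto (fun n => ∑ k ∈ Finset.range n, w (k + 1) ^ (1 - δ) • M k)
      atTop (𝓝 l) := by
    choose l hl using hnoise
    refine ⟨WithLp.toLp 2 fun u => l u / √(fstar u), ?_⟩
    have h1 := tendsto_pi_nhds.2 fun u => (hl u).div_const (√(fstar u))
    refine (((PiLp.continuous_toLp 2 fun _ : U => ℝ).tendsto _).comp h1).congr fun n => ?_
    ext u
    simp only [hM, Function.comp_apply, WithLp.ofLp_sum, Finset.sum_apply, PiLp.smul_apply,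
      smul_eq_mul, Finset.sum_div, mul_div_assoc]
  -- the weight `w 0` is arbitrary, so the recursion is followed from time one
  have key : Tendsto (fun n => w (n + 1) ^ (-δ) • x (n + 1)) atTop (𝓝 0) := by
    refine tendsto_smul_zero_of_linear_recursion (x := fun n => x (n + 1))
      (R := fun n => R (n + 1)) (M := fun n => M (n + 1)) (w := fun n => w (n + 1)) hc hB
      (fun n => (hw _ (Nat.le_add_left _ _)).1) (hw0.comp (tendsto_add_atTop_nat 1))
      (fun hs => hws ((summable_nat_add_iff 1).1 hs)) (hwd.comp (tendsto_add_atTop_nat 1))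
      hδ0 hδ1 (hx0.comp (tendsto_add_atTop_nat 1)) (fun n => hrec (n + 1)) hC
      ((tendsto_add_atTop_nat 1).eventually hRx) ?_
    obtain ⟨l, hl⟩ := hMs
    refine ⟨_, ((hl.comp (tendsto_add_atTop_nat 1)).sub_const
      (w (0 + 1) ^ (1 - δ) • M 0)).congr fun n => ?_⟩
    simp only [Function.comp_apply]
    rw [Finset.sum_range_succ', add_sub_cancel_right]
  have key' : Tendsto (fun n => w n ^ (-δ) • x n) atTop (𝓝 0) :=
    (tendsto_add_atTop_iff_nat 1).1 key
  refine isLittleO_iff.2 fun η hη => ?_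
  filter_upwards [(tendsto_zero_iff_norm_tendsto_zero.1 key').eventually_le_const hη,
    eventually_ge_atTop 1] with n hn h1
  have hwp := Real.rpow_pos_of_pos (hw n h1).1 δ
  rw [norm_smul, Real.rpow_neg (hw n h1).1.le, norm_inv, Real.norm_of_nonneg hwp.le,
    inv_mul_eq_div, div_le_iff₀ hwp] at hn
  rw [Real.norm_of_nonneg hwp.le, euclDist, norm_norm, ← euclDist]
  exact (euclDist_le_norm_deviation h.mem h.weight_pos _).trans hn

/-- The rate for a kernel that is positive everywhere and data that are measurable. -/
theorem IsInteriorMaximizer.ae_isLittleO (h : IsInteriorMaximizer μ p fstar)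
    (hf₀ : f₀ ∈ stdSimplex ℝ U) (hf₀_pos : ∀ u, 0 < f₀ u) {Z : ℕ → Ω → Y}
    (hZ : ∀ n, Measurable (Z n)) (hind : iIndepFun Z P) (hlaw : ∀ n, P.map (Z n) = μ)
    {w : ℕ → ℝ} {ε δ : ℝ} (hw : ∀ n, 1 ≤ n → w n ∈ Set.Ioo (0 : ℝ) 1) (hws : ¬ Summable w)
    (hε : ε ∈ Set.Ioc (0 : ℝ) 1) (hwε : Summable fun n => w n ^ (1 + ε))
    (hwd : Tendsto (fun n => (w (n + 1))⁻¹ - (w n)⁻¹) atTop (𝓝 0))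
    (hδ : δ ∈ Set.Ioc (0 : ℝ) ((1 - ε) / 2)) :
    ∀ᵐ ω ∂P, (fun n => euclDist (prIter p f₀ w (fun i => Z (i - 1) ω) n) fstar)
      =o[atTop] fun n => w n ^ δ := by
  have hμ : IsProbabilityMeasure μ :=
    hlaw 0 ▸ Measure.isProbabilityMeasure_map (hZ 0).aemeasurable
  obtain ⟨L, hL, hge, heq⟩ := h.exists_truncation
  have hδ1 : δ ≤ 1 := by linarith [hδ.2, hε.1]
  have hwpos : ∀ n, 0 < w (n + 1) := fun n => (hw _ (Nat.le_add_left _ _)).1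
  have hsq : Summable fun n => w (n + 1) ^ 2 := by
    refine (summable_rpow_of_le hw (b := 2) (by linarith [hε.2]) hwε).congr fun n => ?_
    rw [Real.rpow_two]
  have hsqδ : Summable fun n => (w (n + 1) ^ (1 - δ)) ^ 2 := by
    refine (summable_rpow_of_le hw (b := (1 - δ) * 2) (by linarith [hδ.2]) hwε).congr fun n => ?_
    rw [Real.rpow_mul (hwpos n).le, Real.rpow_two]
  have hw0 : Tendsto w atTop (𝓝 0) := by
    have h1 := hsq.tendsto_atTop_zero.sqrt
    rw [Real.sqrt_zero] at h1
    exact (tendsto_add_atTop_iff_nat 1).1 (h1.congr fun n => Real.sqrt_sq (hwpos n).le)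
  have hmem := fun ω n => prIter_mem_and_pos h.pos hf₀ hf₀_pos hw (fun i => Z (i - 1) ω) n
  have hF := measurable_history_prIter h.measurable f₀ w Z
  have hA := ae_exists_tendsto_sum_centred hZ hind hlaw
    (measurable_uncurry_truncRatio h.measurable fstar L)
    (fun n ω y => h.abs_truncRatio_le hL (hmem ω n).1 y) hF hsq
  have hBu : ∀ᵐ ω ∂P, ∀ u, _ := ae_all_iff.2 fun u =>
    ae_exists_tendsto_sum_centred hZ hind hlaw
      (measurable_uncurry_relDensity_mul h.measurable u) (B := 1)
      (fun n ω y => by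
        rw [abs_of_nonneg (mul_nonneg (relDensity_pos h.pos (hmem ω n).1 u y).le
          ((hmem ω n).1.1 u))]
        exact relDensity_mul_le_one h.pos (hmem ω n).1 u y) hF hsqδ
  filter_upwards [hA, hBu] with ω hAω hBω
  have hlim := h.tendsto_prIter hf₀ hf₀_pos hw hws ((summable_nat_add_iff 1).1 hsq) hL hge heq
    (y := fun i => Z (i - 1) ω) hAω
  exact h.isLittleO_of_noise hf₀ hf₀_pos hw hws hw0 hwd hδ.1.le hδ1 hlim hBω

end AlmostSure

/-! ### Polynomial weights -/

section Polynomial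

lemma tendsto_inv_rpow_succ_sub {γ : ℝ} (h0 : 0 ≤ γ) (h1 : γ < 1) :
    Tendsto (fun n : ℕ => ((((n + 1 : ℕ) : ℝ) + 1) ^ (-γ))⁻¹ - (((n : ℝ) + 1) ^ (-γ))⁻¹) atTop
      (𝓝 0) := by
  have hlim : Tendsto (fun n : ℕ => ((n : ℝ) + 1) ^ (-(1 - γ))) atTop (𝓝 0) :=
    (tendsto_rpow_neg_atTop (sub_pos.2 h1)).comp
      (tendsto_natCast_atTop_atTop.atTop_add tendsto_const_nhds)
  refine squeeze_zero_norm (fun n => ?_) hlim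
  have hx : (0 : ℝ) < n + 1 := by positivity
  have hq : (0 : ℝ) < (n + 1 + 1) / (n + 1) := by positivity
  push_cast
  rw [Real.rpow_neg (by positivity), Real.rpow_neg hx.le, inv_inv, inv_inv]
  have e1 : ((n : ℝ) + 1 + 1) ^ γ = (n + 1) ^ γ * ((n + 1 + 1) / (n + 1)) ^ γ := by
    rw [← Real.mul_rpow hx.le hq.le, mul_div_cancel₀ _ hx.ne']
  have e2 : ((n : ℝ) + 1 + 1) / (n + 1) - 1 = ((n : ℝ) + 1)⁻¹ := by field_simp; ring
  rw [e1, ← mul_sub_one, norm_mul, Real.norm_of_nonneg (Real.rpow_nonneg hx.le _)]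
  calc ((n : ℝ) + 1) ^ γ * ‖((n + 1 + 1) / (n + 1) : ℝ) ^ γ - 1‖
      ≤ ((n : ℝ) + 1) ^ γ * |((n : ℝ) + 1 + 1) / (n + 1) - 1| := by
        gcongr
        exact abs_rpow_sub_one_le hq h0 h1.le
    _ = ((n : ℝ) + 1) ^ γ * ((n : ℝ) + 1) ^ (-1 : ℝ) := by
        rw [e2, abs_of_pos (inv_pos.2 hx), Real.rpow_neg_one]
    _ = ((n : ℝ) + 1) ^ (-(1 - γ)) := by
        rw [← Real.rpow_add hx]
        congr 1
        ring

lemma isBigO_add_one_rpow_neg {a b : ℝ} (ha : 0 ≤ a) (hba : b ≤ a) :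
    (fun n : ℕ => ((n : ℝ) + 1) ^ (-a)) =O[atTop] fun n : ℕ => (n : ℝ) ^ (-b) := by
  refine IsBigO.of_bound 1 ?_
  filter_upwards [eventually_ge_atTop 1] with n hn
  have hn' : (1 : ℝ) ≤ n := by exact_mod_cast hn
  rw [Real.norm_of_nonneg (by positivity), Real.norm_of_nonneg (by positivity), one_mul]
  exact (Real.rpow_le_rpow_of_nonpos (by linarith) (by linarith) (by linarith)).trans
    (Real.rpow_le_rpow_of_exponent_le hn' (by linarith))

lemma summable_add_one_rpow_neg_iff {a : ℝ} :
    (Summable fun n : ℕ => ((n : ℝ) + 1) ^ (-a)) ↔ 1 < a := by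
  rw [← Real.summable_nat_rpow (p := -a) |>.trans neg_lt_neg_iff,
    ← summable_nat_add_iff 1 (f := fun n : ℕ => (n : ℝ) ^ (-a))]
  simp

end Polynomial

end PredictiveRecursion

theorem theorem2
    {Y U Ω : Type*} [MeasurableSpace Y] [Fintype U] [MeasurableSpace Ω]
    -- dominating measure, kernel, true density
    (lam : Measure Y) [SigmaFinite lam]
    (p : Y → U → ℝ) (hp : ∀ u, PredictiveRecursion.IsDensity lam (fun y => p y u))
    (m : Y → ℝ) (hm : PredictiveRecursion.IsDensity lam m)
    -- identifiability and finiteness of the divergence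
    (hident : PredictiveRecursion.Identifiable lam p)
    (hfin : ∀ f ∈ stdSimplex ℝ U,
      PredictiveRecursion.KL lam m (PredictiveRecursion.mixture p f) < ⊤)
    -- the unique minimizer, in the (relative) interior of the simplex
    (fstar : U → ℝ) (hstar : PredictiveRecursion.IsUniqueKLMinimizer lam p m fstar)
    (hstar_int : ∀ u, 0 < fstar u)
    -- the starting point, with full support
    (f₀ : U → ℝ) (hf₀ : f₀ ∈ stdSimplex ℝ U) (hf₀_pos : ∀ u, 0 < f₀ u)
    -- independent data `X 1, X 2, …` from the density `m`
    (P : Measure Ω) [IsProbabilityMeasure P] (X : ℕ → Ω → Y)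
    (hX_law : ∀ n, 1 ≤ n → HasLaw (X n) (PredictiveRecursion.law lam m) P)
    (hX_indep : iIndepFun (fun n : ℕ => X (n + 1)) P) :
    (∀ (w : ℕ → ℝ) (ε δ : ℝ),
      (∀ n, 1 ≤ n → w n ∈ Set.Ioo (0 : ℝ) 1) →
      ¬ Summable w →
      ε ∈ Set.Ioc (0 : ℝ) 1 →
      Summable (fun n => w n ^ (1 + ε)) →
      Tendsto (fun n => (w (n + 1))⁻¹ - (w n)⁻¹) atTop (𝓝 0) →
      δ ∈ Set.Ioc (0 : ℝ) ((1 - ε) / 2) →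
      ∀ᵐ ω ∂P,
        (fun n => PredictiveRecursion.euclDist
          (PredictiveRecursion.prIter p f₀ w (fun i => X i ω) n) fstar)
          =o[atTop] (fun n => w n ^ δ)) ∧
    (∀ γ β : ℝ, γ ∈ Set.Ioo (1 / 2 : ℝ) 1 → β < γ - 1 / 2 →
      ∀ᵐ ω ∂P,
        (fun n => PredictiveRecursion.euclDist
          (PredictiveRecursion.prIter p f₀ (fun i => ((i : ℝ) + 1) ^ (-γ)) (fun i => X i ω) n)
          fstar)
          =o[atTop] (fun n => (n : ℝ) ^ (-β))) := by
  have hmax := PredictiveRecursion.isInteriorMaximizer_positiveKernel hp hm hfin hstar hstar_int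
  have hlaw := fun n => hX_law (n + 1) (Nat.le_add_left 1 n)
  -- measurable versions of the observations
  set Z : ℕ → Ω → Y := fun n => (hlaw n).aemeasurable.mk with hZ
  have hXZ : ∀ n, X (n + 1) =ᵐ[P] Z n := fun n => (hlaw n).aemeasurable.ae_eq_mk
  have hZlaw : ∀ n, P.map (Z n) = PredictiveRecursion.law lam m := fun n => by
    rw [← Measure.map_congr (hXZ n), (hlaw n).map_eq]
  have hpos : ∀ᵐ ω ∂P, ∀ n u, 0 < p (X (n + 1) ω) u := ae_all_iff.2 fun n => by
    have h1 := PredictiveRecursion.ae_pos_of_forall_KL_lt_top hp hfin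
    rw [← (hlaw n).map_eq] at h1
    exact ae_of_ae_map (hlaw n).aemeasurable h1
  have hiter : ∀ w : ℕ → ℝ, ∀ᵐ ω ∂P, ∀ n, PredictiveRecursion.prIter p f₀ w (fun i => X i ω) n
      = PredictiveRecursion.prIter (PredictiveRecursion.positiveKernel p) f₀ w
        (fun i => Z (i - 1) ω) n := fun w => by
    filter_upwards [hpos, ae_all_iff.2 hXZ] with ω h1 h2 n
    refine PredictiveRecursion.prIter_congr (fun k => ?_) n
    rw [Nat.add_sub_cancel, ← h2 k, PredictiveRecursion.positiveKernel_of_pos (h1 k)]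
  have hmain : ∀ (w : ℕ → ℝ) (ε δ : ℝ),
      (∀ n, 1 ≤ n → w n ∈ Set.Ioo (0 : ℝ) 1) →
      ¬ Summable w →
      ε ∈ Set.Ioc (0 : ℝ) 1 →
      Summable (fun n => w n ^ (1 + ε)) →
      Tendsto (fun n => (w (n + 1))⁻¹ - (w n)⁻¹) atTop (𝓝 0) →
      δ ∈ Set.Ioc (0 : ℝ) ((1 - ε) / 2) →
      ∀ᵐ ω ∂P,
        (fun n => PredictiveRecursion.euclDist
          (PredictiveRecursion.prIter p f₀ w (fun i => X i ω) n) fstar)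
          =o[atTop] (fun n => w n ^ δ) := by
    intro w ε δ hw hws hε hwε hwd hδ
    filter_upwards [hiter w, hmax.ae_isLittleO hf₀ hf₀_pos
      (fun n => (hlaw n).aemeasurable.measurable_mk) (hX_indep.congr hXZ) hZlaw
      hw hws hε hwε hwd hδ] with ω h1 h2
    simpa only [h1] using h2
  refine ⟨hmain, fun γ β hγ hβ => ?_⟩
  have hγ0 : 0 < γ := by linarith [hγ.1]
  -- `γ * (1 + ε) > 1` makes the weights summable; `γ * (1 - ε) / 2 ≥ β` makes the rate sufficient
  obtain ⟨ε, hε1, hε2⟩ : ∃ ε, γ⁻¹ - 1 < ε ∧ ε < min 1 (1 - 2 * β / γ) := by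
    refine exists_between (lt_min ?_ ?_)
    · have : γ⁻¹ < 2 := by
        rw [inv_lt_comm₀ hγ0 two_pos]; linarith [hγ.1]
      linarith
    · have : 0 < (2 * γ - 1 - 2 * β) / γ := div_pos (by linarith) hγ0
      have e : (2 * γ - 1 - 2 * β) / γ = (1 - 2 * β / γ) - (γ⁻¹ - 1) := by field_simp; ring
      linarith
  have hε0 : 0 < ε := by
    have := (one_lt_inv₀ hγ0).2 hγ.2
    linarith
  have hε3 := lt_min_iff.1 hε2
  have hγε : 1 < γ * (1 + ε) := by
    have := mul_lt_mul_of_pos_left (show γ⁻¹ < 1 + ε by linarith) hγ0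
    rwa [mul_inv_cancel₀ hγ0.ne'] at this
  have hβε : β ≤ γ * ((1 - ε) / 2) := by
    have h1 : 2 * β / γ < 1 - ε := by linarith [hε3.2]
    rw [div_lt_iff₀ hγ0] at h1
    linarith
  have h := hmain (fun i => ((i : ℝ) + 1) ^ (-γ)) ε ((1 - ε) / 2)
    (fun n hn => ⟨by positivity, Real.rpow_lt_one_of_one_lt_of_neg
      (by have : (1 : ℝ) ≤ n := by exact_mod_cast hn
          linarith) (by linarith)⟩)
    (fun hs => absurd (PredictiveRecursion.summable_add_one_rpow_neg_iff.1 hs)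
      (not_lt.2 hγ.2.le))
    ⟨hε0, hε3.1.le⟩
    ((PredictiveRecursion.summable_add_one_rpow_neg_iff.2 hγε).congr fun n => by
      rw [← Real.rpow_mul (by positivity), neg_mul])
    (PredictiveRecursion.tendsto_inv_rpow_succ_sub hγ0.le hγ.2)
    ⟨by linarith [hε3.1], le_rfl⟩
  filter_upwards [h] with ω hω
  refine hω.trans_isBigO ((PredictiveRecursion.isBigO_add_one_rpow_neg
    (mul_nonneg hγ0.le (by linarith [hε3.1] : (0 : ℝ) ≤ (1 - ε) / 2)) hβε).congr_left fun n => ?_)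
  rw [← Real.rpow_mul (by positivity), neg_mul]
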